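/- **Proposition (the heat semigroup $e^{t\Delta_{\hat A}}$ is smoothing on $L^2(\mathbb R^n)$).** Let $\mathfrak g$ be a finite-dimensional real Lie algebra with an inner product satisfying $\langle [X,Y],Z\rangle=\langle X,[Y,Z]\rangle$ (the Lie algebra of a compact Lie group with a bi-invariant metric), and let $\hat A=(\hat A_1,\dots,\hat A_n)$, $\hat A_i\in L^2_{\mathrm{loc}}(\mathbb R^n,\mathfrak g)$, be a connection on the (trivial) principal bundle over $\mathbb R^n$; this includes all smooth connections and all connections of class $H^s(\mathbb R^n)$, $s\ge 0$. Put $\hat\nabla_i\varphi=\partial_i\varphi+[\hat A_i,\varphi]$ for $\mathfrak g$-valued functions $\varphi$ (sections of the adjoint bundle), and assume that $\hat A$ is irreducible: the only $\varphi\in L^2_{\mathrm{loc}}(\mathbb R^n,\mathfrak g)$ with $\hat\nabla_i\varphi=0$ weakly for all $i$ is $\varphi=0$. Let $\Delta_{\hat A}=\sum_i\hat\nabla_i\hat\nabla_i=-\hat\nabla^*\hat\nabla$ be the gauge-covariant Laplacian on $L^2(\mathbb R^n,\mathfrak g)$, where $\hat\nabla$ is the closure of the covariant derivative on $C_c^\infty(\mathbb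 R^n,\mathfrak g)$ and $\hat\nabla^*$ its adjoint. Then $-\Delta_{\hat A}$ has a spectral resolution $-\Delta_{\hat A}=\int\lambda\,dE_\lambda$, and for every $t>0$ the operator $$e^{t\Delta_{\hat A}}:=\int e^{-t\lambda}\,dE_\lambda$$ is a bounded operator on $L^2(\mathbb R^n,\mathfrak g)$. For $k\ge 1$ let $H^{2k}$ be the domain of $(-\Delta_{\hat A})^k$ with the gauge-invariant Sobolev norm $$\|h\|_{H^{2k}}^2=\sum_{I=0}^{2k}\langle h,(-\Delta_{\hat A})^I h\rangle_{L^2},$$ where $\langle h,(-\Delta_{\hat A})^I h\rangle$ is read as $\langle(-\Delta_{\hat A})^{\lfloor I/2\rfloor}h,(-\Delta_{\hat A})^{\lceil I/2\rceil}h\rangle$. Then for every integer $k\ge1$ there is a constant $C_k$, depending only on $k$ (not on $n,\mathfrak g,\hat A,t,f$), such that for all $t>0$ and all $f\in L^2(\mathbb R^n,\mathfrak g)$ $$e^{t\Delta_{\hat A}}f\in H^{2k}\qquad\text{and}\qquad \|e^{t\Delta_{\hat A}}f\|_{H^{2k}}\le C_k\,(1+t^{-k})\,\|f\|_{L^2}.$$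 -/

import Mathlib

open MeasureTheory Filter Topology
open scoped ContDiff

noncomputable section

namespace GaugeHeat

/-! ### Lie algebras of compact Lie groups -/

/-- A Lie ring carrying a norm (no compatibility yet; this only makes the two additive group
structures agree). -/
class NormedLieRing (𝔤 : Type*) extends NormedAddCommGroup 𝔤, LieRing 𝔤

/-- A real Lie algebra with an adjoint-invariant inner product, `⟨[X, Y], Z⟩ = ⟨X, [Y, Z]⟩`.
The finite-dimensional ones are exactly the Lie algebras of compact Lie groups with a bi-invariant
metric. -/
class InvariantLieAlgebra (𝔤 : Type*) [NormedLieRing 𝔤]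
    extends InnerProductSpace ℝ 𝔤, LieAlgebra ℝ 𝔤 where
  inner_lie : ∀ X Y Z : 𝔤, Inner.inner ℝ ⁅X, Y⁆ Z = Inner.inner ℝ X ⁅Y, Z⁆

/-! ### Connections and the gauge-covariant Laplacian -/

section Connection

/-- Euclidean space `ℝⁿ`. -/
abbrev Space (n : ℕ) : Type := EuclideanSpace ℝ (Fin n)

/-- The Hilbert space `L²(ℝⁿ, 𝔤)` of square-integrable sections of the adjoint bundle. Every
principal bundle over `ℝⁿ` is trivial, so sections of the adjoint bundle are `𝔤`-valued
functions. -/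
abbrev L2Section (n : ℕ) (𝔤 : Type*) [NormedAddCommGroup 𝔤] : Type _ :=
  Lp 𝔤 2 (volume : Measure (Space n))

/-- The Hilbert space of square-integrable `𝔤`-valued one-forms on `ℝⁿ`, given by their components
`(G₁, …, Gₙ)`, with `‖G‖² = ∑ᵢ ‖Gᵢ‖²`. -/
abbrev L2OneForm (n : ℕ) (𝔤 : Type*) [NormedAddCommGroup 𝔤] : Type _ :=
  PiLp 2 (fun _ : Fin n => L2Section n 𝔤)

/-- Local square-integrability on `ℝⁿ`. -/
def LocallyL2 {n : ℕ} {𝔤 : Type*} [NormedAddCommGroup 𝔤] (f : Space n → 𝔤) : Prop :=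
  ∀ K : Set (Space n), IsCompact K → MemLp f 2 (volume.restrict K)

/-- A connection on the (trivial) bundle over `ℝⁿ`: a `𝔤`-valued one-form with components
`A₁, …, Aₙ`. Only local square-integrability is required, so that smooth connections and all
Sobolev classes `Hˢ(ℝⁿ)`, `s ≥ 0`, are included. -/
structure Connection (n : ℕ) (𝔤 : Type*) [NormedAddCommGroup 𝔤] where
  /-- The components of the connection one-form. -/
  toFun : Fin n → Space n → 𝔤
  locallyL2 : ∀ i, LocallyL2 (toFun i)

/-- Smooth compactly supported sections. -/
structure IsTestSection {n : ℕ} {𝔤 : Type*} [NormedAddCommGroup 𝔤] [NormedSpace ℝ 𝔤]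
    (φ : Space n → 𝔤) : Prop where
  contDiff : ContDiff ℝ ∞ φ
  hasCompactSupport : HasCompactSupport φ

variable {n : ℕ} {𝔤 : Type*} [NormedLieRing 𝔤] [InvariantLieAlgebra 𝔤]

/-- The gauge-covariant derivative `∇̂ᵢ φ = ∂ᵢ φ + [Aᵢ, φ]`. -/
def covDeriv (A : Connection n 𝔤) (i : Fin n) (φ : Space n → 𝔤) (x : Space n) : 𝔤 :=
  fderiv ℝ φ x (EuclideanSpace.single i 1) + ⁅A.toFun i x, φ x⁆

/-- `A` is irreducible: the kernel of `∇̂` on sections of the adjoint bundle is trivial, i.e. every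
section with `∇̂ᵢ φ = 0` for all `i` vanishes. The equation is understood in the weak sense; by
invariance of the inner product the formal adjoint of `∇̂ᵢ` is `-∇̂ᵢ`. -/
def Connection.Irreducible (A : Connection n 𝔤) : Prop :=
  ∀ φ : Space n → 𝔤, LocallyL2 φ →
    (∀ (i : Fin n) (ψ : Space n → 𝔤), IsTestSection ψ →
      ∫ x, inner ℝ (φ x) (covDeriv A i ψ x) = 0) →
    φ =ᵐ[volume] 0

/-- The graph of `φ ↦ (∇̂₁ φ, …, ∇̂ₙ φ)` on smooth compactly supported sections, in
`L²(ℝⁿ, 𝔤) × L²(ℝⁿ, 𝔤)ⁿ`. -/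
def covGradGraph (A : Connection n 𝔤) : Submodule ℝ (L2Section n 𝔤 × L2OneForm n 𝔤) where
  carrier := {p | ∃ φ : Space n → 𝔤, IsTestSection φ ∧ p.1 =ᵐ[volume] φ ∧
    ∀ i, p.2 i =ᵐ[volume] covDeriv A i φ}
  add_mem' := by
    rintro p q ⟨φ, hφ, hp, hp'⟩ ⟨ψ, hψ, hq, hq'⟩
    refine ⟨φ + ψ, ⟨hφ.1.add hψ.1, hφ.2.add hψ.2⟩, ?_, fun i => ?_⟩
    · exact (Lp.coeFn_add _ _).trans (hp.add hq)
    · refine (Lp.coeFn_add (p.2 i) (q.2 i)).trans (((hp' i).add (hq' i)).trans ?_)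
      refine Eventually.of_forall fun x => ?_
      have h1 := (hφ.1.differentiable (by simp)) x
      have h2 := (hψ.1.differentiable (by simp)) x
      simp only [covDeriv, Pi.add_apply, fderiv_add h1 h2, add_apply, lie_add]
      abel
  zero_mem' := by
    refine ⟨0, ⟨contDiff_const, HasCompactSupport.zero⟩, Lp.coeFn_zero _ _ _, fun i => ?_⟩
    refine (Lp.coeFn_zero _ _ _).trans (Eventually.of_forall fun x => ?_)
    simp [covDeriv]
  smul_mem' := by
    rintro c p ⟨φ, hφ, hp, hp'⟩
    refine ⟨c • φ, ⟨hφ.1.const_smul c, hφ.2.smul_left (f := fun _ => c)⟩, ?_, fun i => ?_⟩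
    · exact (Lp.coeFn_smul _ _).trans (hp.const_smul c)
    · refine (Lp.coeFn_smul c (p.2 i)).trans (((hp' i).const_smul c).trans ?_)
      refine Eventually.of_forall fun x => ?_
      have h1 := (hφ.1.differentiable (by simp)) x
      simp only [covDeriv, Pi.smul_apply, fderiv_const_smul h1 c, smul_apply,
        lie_smul, smul_add]

/-- The graph is that of a single-valued operator, so `covGrad` below is not a junk value. -/
theorem covGradGraph_single (A : Connection n 𝔤) :
    ∀ p ∈ covGradGraph A, p.1 = 0 → p.2 = 0 := by
  rintro p ⟨φ, hφ, hp, hp'⟩ h0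
  have hae : φ =ᵐ[volume] (0 : Space n → 𝔤) := by
    rw [h0] at hp
    exact hp.symm.trans (Lp.coeFn_zero _ _ _)
  have hz : φ = 0 := (hφ.1.continuous.ae_eq_iff_eq volume continuous_zero).1 hae
  ext1 i
  refine Lp.ext ((hp' i).trans (EventuallyEq.trans ?_ (Lp.coeFn_zero _ _ _).symm))
  refine Eventually.of_forall fun x => ?_
  simp [covDeriv, hz]

/-- The covariant derivative `∇̂ φ = (∇̂₁ φ, …, ∇̂ₙ φ)` as a densely defined operator
`L²(ℝⁿ, 𝔤) → L²(ℝⁿ, 𝔤)ⁿ` with domain the smooth compactly supported sections. -/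
def covGrad (A : Connection n 𝔤) : L2Section n 𝔤 →ₗ.[ℝ] L2OneForm n 𝔤 :=
  (covGradGraph A).toLinearPMap

end Connection

section Operators

/-- The composition `g ∘ f` of partially defined operators on its natural domain
`{x ∈ dom f | f x ∈ dom g}`. -/
def pcomp {E F G : Type*} [AddCommGroup E] [Module ℝ E] [AddCommGroup F] [Module ℝ F]
    [AddCommGroup G] [Module ℝ G] (g : F →ₗ.[ℝ] G) (f : E →ₗ.[ℝ] F) : E →ₗ.[ℝ] G :=
  g.comp (f.domRestrict ((g.domain.comap f.toFun).map f.domain.subtype)) (by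
    intro x
    obtain ⟨y, hy, hyx⟩ := Submodule.mem_map.1 x.2.1
    have h : f.domRestrict ((g.domain.comap f.toFun).map f.domain.subtype) x = f y :=
      LinearPMap.domRestrict_apply hyx.symm
    rw [h]
    exact hy)

variable {n : ℕ} {𝔤 : Type*} [NormedLieRing 𝔤] [InvariantLieAlgebra 𝔤] [FiniteDimensional ℝ 𝔤]

instance : CompleteSpace 𝔤 := FiniteDimensional.complete ℝ 𝔤

/-- The gauge-covariant Laplacian `Δ_A = δⁱʲ ∇̂ᵢ ∇̂ⱼ = -∇̂* ∇̂` on `L²(ℝⁿ, 𝔤)`: here `∇̂` is the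
closure of the covariant derivative on smooth compactly supported sections and `∇̂*` its Hilbert
space adjoint. Thus `Δ_A f = g` iff `f` lies in the completion of the test sections for the norm
`(‖f‖² + ‖∇̂ f‖²)^{1/2}` and `∑ᵢ ⟪∇̂ᵢ f, ∇̂ᵢ φ⟫ = -⟪g, φ⟫` for all test sections `φ`. -/
def covLaplacian (A : Connection n 𝔤) : L2Section n 𝔤 →ₗ.[ℝ] L2Section n 𝔤 :=
  -(pcomp (covGrad A).adjoint (covGrad A).closure)

end Operators

/-! ### Spectral resolutions -/

section Spectral

variable {H : Type*} [NormedAddCommGroup H] [InnerProductSpace ℝ H]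

/-- A resolution of the identity `(E_λ)` on a real Hilbert space: an increasing, strongly
right-continuous family of orthogonal projections with `E_λ → 0` at `-∞` and `E_λ → 1` at `+∞`. -/
structure ResolutionOfIdentity (H : Type*) [NormedAddCommGroup H] [InnerProductSpace ℝ H] where
  /-- The projections `E_λ`. -/
  proj : ℝ → H →L[ℝ] H
  symm : ∀ a x y, inner ℝ (proj a x) y = inner ℝ x (proj a y)
  proj_proj : ∀ a b x, proj a (proj b x) = proj (min a b) x
  right_continuous : ∀ a x, Tendsto (fun b => proj b x) (𝓝[>] a) (𝓝 (proj a x))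
  tendsto_atBot : ∀ x, Tendsto (fun b => proj b x) atBot (𝓝 0)
  tendsto_atTop : ∀ x, Tendsto (fun b => proj b x) atTop (𝓝 x)

namespace ResolutionOfIdentity

theorem norm_proj_le (E : ResolutionOfIdentity H) (a : ℝ) (x : H) : ‖E.proj a x‖ ≤ ‖x‖ := by
  have h : ‖E.proj a x‖ * ‖E.proj a x‖ ≤ ‖x‖ * ‖E.proj a x‖ := by
    rw [← real_inner_self_eq_norm_mul_norm, E.symm, E.proj_proj, min_self]
    exact real_inner_le_norm _ _
  rcases (norm_nonneg (E.proj a x)).eq_or_lt with h0 | h0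
  · rw [← h0]; exact norm_nonneg x
  · exact le_of_mul_le_mul_right h h0

/-- The spectral measure `d‖E_λ x‖²` of the vector `x`. -/
def spectralMeasure (E : ResolutionOfIdentity H) (x : H) : Measure ℝ :=
  StieltjesFunction.measure
    { toFun := fun a => ‖E.proj a x‖ ^ 2
      mono' := by
        intro a b hab
        have h : E.proj a x = E.proj a (E.proj b x) := by rw [E.proj_proj, min_eq_left hab]
        have h' := E.norm_proj_le a (E.proj b x)
        rw [← h] at h'
        exact pow_le_pow_left₀ (norm_nonneg _) h' 2
      right_continuous' := by
        intro a
        rw [← continuousWithinAt_Ioi_iff_Ici]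
        exact ((E.right_continuous a x).norm.pow 2) }

/-- `E.HasIntegral φ x y` says that `x` lies in the domain of the operator `∫ φ(λ) dE_λ`, i.e.
`∫ φ² d‖E_λ x‖² < ∞`, and that `y = (∫ φ(λ) dE_λ) x`, i.e. `⟪y, z⟫ = ∫ φ(λ) d⟪E_λ x, z⟫` for all
`z` in the domain, where `d⟪E_λ x, z⟫ = (d‖E_λ (x + z)‖² - d‖E_λ (x - z)‖²) / 4`. -/
def HasIntegral (E : ResolutionOfIdentity H) (φ : ℝ → ℝ) (x y : H) : Prop :=
  MemLp φ 2 (E.spectralMeasure x) ∧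
  ∀ z : H, MemLp φ 2 (E.spectralMeasure z) →
    inner ℝ y z = ((∫ a, φ a ∂(E.spectralMeasure (x + z)))
      - ∫ a, φ a ∂(E.spectralMeasure (x - z))) / 4

/-- `E` is the spectral resolution of the operator `T`: `T = ∫ λ dE_λ`, including equality of
domains. -/
def IsSpectralResolution (E : ResolutionOfIdentity H) (T : H →ₗ.[ℝ] H) : Prop :=
  ∀ x y : H, (x, y) ∈ T.graph ↔ E.HasIntegral (fun a => a) x y

end ResolutionOfIdentity

end Spectral

/-! ### Sobolev spaces through powers of an operator -/

section Sobolev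

variable {H : Type*} [NormedAddCommGroup H] [InnerProductSpace ℝ H]

open Classical in
/-- The value `T x` if `x ∈ dom T`, and `0` otherwise. -/
def value (T : H →ₗ.[ℝ] H) (x : H) : H :=
  if h : x ∈ T.domain then T ⟨x, h⟩ else 0

/-- `x ∈ dom Tᵏ`, i.e. `x, T x, …, Tᵏ⁻¹ x` all lie in `dom T`. For `T = -Δ_A` this is the
gauge-covariant Sobolev space `H²ᵏ`. -/
def MemDomPow (T : H →ₗ.[ℝ] H) (k : ℕ) (x : H) : Prop :=
  ∀ j < k, (value T)^[j] x ∈ T.domain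

/-- The Sobolev norm of order `2k` on `dom Tᵏ`: `‖x‖² = ∑_{I = 0}^{2k} ⟪x, T^I x⟫`. To make sense
on all of `dom Tᵏ`, the term `⟪x, T^I x⟫` is written as `⟪T^{⌊I/2⌋} x, T^{⌈I/2⌉} x⟫`, which is the
same on `dom T^{2k}` for symmetric `T`. -/
def sobolevNorm (T : H →ₗ.[ℝ] H) (k : ℕ) (x : H) : ℝ :=
  Real.sqrt (∑ I ∈ Finset.range (2 * k + 1),
    inner ℝ ((value T)^[I / 2] x) ((value T)^[I - I / 2] x))

end Sobolev

end GaugeHeat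

end

noncomputable section

namespace GaugeHeat

/-! ### Bounded Borel functions and weighted measures on the line -/

section

open Set

/-! Write `D` for the closure of the covariant derivative and `T = D* D = -Δ_A`. The estimate is
functional calculus: `T^j e^{-tT} = ∫ λ^j e^{-tλ} dE_λ`, and `λ^j e^{-tλ} ≤ j! t^{-j}` on the
half-line because `s^j / j! ≤ e^s`. Each of the `2k + 1` terms of the squared Sobolev norm is then
bounded by Cauchy–Schwarz (`sobolevNorm_heat_le`).

The calculus is built from the spectral measures `d‖E_λ x‖²`. A bounded Borel `φ` gives a bounded
bilinear form by polarization, hence an operator `fc φ`. The spectral measure of `fc φ x` is `φ²`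
times that of `x`, so `fc φ x` lies in the domain of an unbounded `∫ ψ dE` as soon as `φ ψ` is
bounded, provided `φ ≥ 0` (`hasIntegral_fc_mul`). Any spectral resolution of `T ≥ 0` lives on `[0,
∞)` (`IsSpectralResolution.nonneg`), which makes `e^{-tλ}` effectively bounded.

Existence of the resolution goes through the resolvent. Invariance of the inner product and
integration by parts give `∇̂ᵢ` the formal adjoint `-∇̂ᵢ`, so the covariant derivative is closable.
Projecting `(x, 0)` orthogonally onto the closed graph and keeping the first component yields `R =
(1 + D* D)⁻¹`, a self-adjoint injective operator with `0 ≤ R ≤ 1` (von Neumann). Since `R⁻¹ - 1 ≤ a`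
means `(1 + a) R - 1 ≥ 0`, the spectral subspace for `(-∞, a]` is taken to be `ker (|B| - B)` for a
positive multiple `B` of `(1 + a) R - 1`, with `|B| = √(B²)` given by a power series. Finally `∫ (1
+ λ)⁻¹ dE_λ = R` (`fc_resolventFun`), and both `T` and `∫ λ dE_λ` are determined by this common
resolvent. -/

/-- A bounded Borel function on the line. -/
structure BddMeas (φ : ℝ → ℝ) : Prop where
  measurable : Measurable φ
  bdd : ∃ M, ∀ a, |φ a| ≤ M

namespace BddMeas

variable {φ ψ : ℝ → ℝ}

theorem integrable (h : BddMeas φ) (ν : Measure ℝ) [IsFiniteMeasure ν] : Integrable φ ν := by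
  obtain ⟨M, hM⟩ := h.bdd
  exact Integrable.of_bound h.measurable.aestronglyMeasurable M (Eventually.of_forall hM)

theorem memLp (h : BddMeas φ) (ν : Measure ℝ) [IsFiniteMeasure ν] : MemLp φ 2 ν := by
  obtain ⟨M, hM⟩ := h.bdd
  exact MemLp.of_bound h.measurable.aestronglyMeasurable M (Eventually.of_forall hM)

theorem mul (h : BddMeas φ) (h' : BddMeas ψ) : BddMeas (fun a => φ a * ψ a) := by
  obtain ⟨M, hM⟩ := h.bdd
  obtain ⟨N, hN⟩ := h'.bdd
  refine ⟨h.measurable.mul h'.measurable, M * N, fun a => ?_⟩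
  rw [abs_mul]
  exact mul_le_mul (hM a) (hN a) (abs_nonneg _) ((abs_nonneg _).trans (hM a))

theorem indicator (h : BddMeas φ) {s : Set ℝ} (hs : MeasurableSet s) :
    BddMeas (s.indicator φ) := by
  obtain ⟨M, hM⟩ := h.bdd
  refine ⟨h.measurable.indicator hs, M, fun a => ?_⟩
  by_cases ha : a ∈ s
  · simpa [ha] using hM a
  · simpa [ha] using (abs_nonneg _).trans (hM a)

theorem const (c : ℝ) : BddMeas (fun _ => c) := ⟨measurable_const, |c|, fun _ => le_rfl⟩

end BddMeas

/-- Reduces identities between spectral measures to identities between the quadratic forms `⟪E_a x,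
x⟫`. -/
theorem measure_eq_of_real_Iic {μ ν : Measure ℝ} [IsFiniteMeasure μ] [IsFiniteMeasure ν]
    (h : ∀ a, μ.real (Iic a) = ν.real (Iic a)) : μ = ν :=
  Measure.ext_of_Iic _ _ fun a => (measureReal_eq_measureReal_iff).1 (h a)

instance (c : ℝ) (ν : Measure ℝ) [IsFiniteMeasure ν] :
    IsFiniteMeasure (ENNReal.ofReal c • ν) := Measure.smul_finite _ ENNReal.ofReal_ne_top

theorem real_add_apply (μ ν : Measure ℝ) [IsFiniteMeasure μ] [IsFiniteMeasure ν] (s : Set ℝ) :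
    (μ + ν).real s = μ.real s + ν.real s := measureReal_add_apply

theorem real_smul_apply {c : ℝ} (hc : 0 ≤ c) (μ : Measure ℝ) (s : Set ℝ) :
    (ENNReal.ofReal c • μ).real s = c * μ.real s := by
  rw [measureReal_ennreal_smul_apply, ENNReal.toReal_ofReal hc]

/-- The measure `φ ν`. -/
def weighted (φ : ℝ → ℝ) (ν : Measure ℝ) : Measure ℝ := ν.withDensity fun a => ENNReal.ofReal (φ a)

section weighted

variable {φ ψ : ℝ → ℝ} {ν : Measure ℝ}

theorem isFiniteMeasure_weighted [IsFiniteMeasure ν] (h : BddMeas φ) : IsFiniteMeasure (weighted φ ν) :=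
  isFiniteMeasure_withDensity_ofReal (h.integrable ν).2

theorem integral_weighted (h : Measurable φ) (h0 : ∀ a, 0 ≤ φ a) (ψ : ℝ → ℝ) :
    ∫ a, ψ a ∂(weighted φ ν) = ∫ a, φ a * ψ a ∂ν := by
  rw [weighted, integral_withDensity_eq_integral_toReal_smul h.ennreal_ofReal (by simp)]
  refine integral_congr_ae (Eventually.of_forall fun a => ?_)
  simp [ENNReal.toReal_ofReal (h0 a)]

theorem integrable_weighted (h : Measurable φ) (h0 : ∀ a, 0 ≤ φ a) :
    Integrable ψ (weighted φ ν) ↔ Integrable (fun a => φ a * ψ a) ν := by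
  rw [weighted, integrable_withDensity_iff_integrable_smul' h.ennreal_ofReal (by simp)]
  refine integrable_congr (Eventually.of_forall fun a => ?_)
  simp [ENNReal.toReal_ofReal (h0 a)]

theorem weighted_real_Iic [IsFiniteMeasure ν] (h : BddMeas φ) (h0 : ∀ a, 0 ≤ φ a) (a : ℝ) :
    (weighted φ ν).real (Iic a) = ∫ b, (Iic a).indicator φ b ∂ν := by
  have := isFiniteMeasure_weighted (ν := ν) h
  rw [← integral_indicator_one measurableSet_Iic, integral_weighted h.measurable h0]
  refine integral_congr_ae (Eventually.of_forall fun b => ?_)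
  by_cases hb : b ∈ Iic a <;> simp [hb]

end weighted

/-! ### Spectral measures and the bounded functional calculus -/

namespace ResolutionOfIdentity

variable {H : Type*} [NormedAddCommGroup H] [InnerProductSpace ℝ H] (E : ResolutionOfIdentity H)

theorem norm_proj_sq (a : ℝ) (x : H) : ‖E.proj a x‖ ^ 2 = inner ℝ (E.proj a x) x := by
  rw [← real_inner_self_eq_norm_sq, ← E.symm, E.proj_proj, min_self]

theorem spectralMeasure_Iic (x : H) (a : ℝ) :
    E.spectralMeasure x (Iic a) = ENNReal.ofReal (‖E.proj a x‖ ^ 2) := by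
  have h : Tendsto (fun b => ‖E.proj b x‖ ^ 2) atBot (𝓝 0) := by
    simpa using (E.tendsto_atBot x).norm.pow 2
  rw [spectralMeasure, StieltjesFunction.measure_Iic _ h]
  simp

theorem spectralMeasure_univ (x : H) : E.spectralMeasure x univ = ENNReal.ofReal (‖x‖ ^ 2) := by
  have h : Tendsto (fun b => ‖E.proj b x‖ ^ 2) atBot (𝓝 0) := by
    simpa using (E.tendsto_atBot x).norm.pow 2
  rw [spectralMeasure, StieltjesFunction.measure_univ _ h ((E.tendsto_atTop x).norm.pow 2)]
  simp

instance (x : H) : IsFiniteMeasure (E.spectralMeasure x) :=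
  ⟨by rw [spectralMeasure_univ]; exact ENNReal.ofReal_lt_top⟩

theorem spectralMeasure_real_Iic (x : H) (a : ℝ) :
    (E.spectralMeasure x).real (Iic a) = inner ℝ (E.proj a x) x := by
  rw [measureReal_def, spectralMeasure_Iic, ENNReal.toReal_ofReal (by positivity), norm_proj_sq]

theorem spectralMeasure_real_univ (x : H) : (E.spectralMeasure x).real univ = ‖x‖ ^ 2 := by
  rw [measureReal_def, spectralMeasure_univ, ENNReal.toReal_ofReal (by positivity)]

theorem inner_proj_comm (a : ℝ) (x y : H) :
    inner ℝ (E.proj a x) y = inner ℝ (E.proj a y) x := by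
  rw [E.symm, real_inner_comm]

theorem spectralMeasure_smul (c : ℝ) (x : H) :
    E.spectralMeasure (c • x) = ENNReal.ofReal (c ^ 2) • E.spectralMeasure x := by
  refine measure_eq_of_real_Iic fun a => ?_
  simp only [real_smul_apply (sq_nonneg c), spectralMeasure_real_Iic, map_smul,
    real_inner_smul_left, real_inner_smul_right]
  ring

theorem spectralMeasure_neg (x : H) : E.spectralMeasure (-x) = E.spectralMeasure x := by
  simpa using E.spectralMeasure_smul (-1) x

theorem spectralMeasure_zero : E.spectralMeasure (0 : H) = 0 := by
  simpa using E.spectralMeasure_smul 0 (0 : H)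

theorem spectralMeasure_parallelogram (x z : H) :
    E.spectralMeasure (x + z) + E.spectralMeasure (x - z)
      = ENNReal.ofReal 2 • E.spectralMeasure x + ENNReal.ofReal 2 • E.spectralMeasure z := by
  refine measure_eq_of_real_Iic fun a => ?_
  simp only [real_add_apply, real_smul_apply zero_le_two, spectralMeasure_real_Iic,
    map_add, map_sub, inner_add_left, inner_add_right, inner_sub_left, inner_sub_right]
  ring

/-- Additivity of `d⟪E_λ x, z⟫` in `x`, with the terms arranged so that only sums of positive
measures occur. The next two lemmas use the same device. -/
theorem spectralMeasure_add_add (x x' z : H) :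
    E.spectralMeasure (x + x' + z) + E.spectralMeasure (x - z) + E.spectralMeasure (x' - z)
      = E.spectralMeasure (x + x' - z) + E.spectralMeasure (x + z)
        + E.spectralMeasure (x' + z) := by
  refine measure_eq_of_real_Iic fun a => ?_
  simp only [real_add_apply, spectralMeasure_real_Iic,
    map_add, map_sub, inner_add_left, inner_add_right, inner_sub_left, inner_sub_right,
    E.inner_proj_comm a z]
  ring

theorem spectralMeasure_smul_add {c : ℝ} (hc : 0 ≤ c) (x z : H) :
    E.spectralMeasure (c • x + z) + ENNReal.ofReal c • E.spectralMeasure (x - z)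
      = E.spectralMeasure (c • x - z) + ENNReal.ofReal c • E.spectralMeasure (x + z) := by
  refine measure_eq_of_real_Iic fun a => ?_
  simp only [real_add_apply, real_smul_apply hc, spectralMeasure_real_Iic,
    map_add, map_sub, map_smul, inner_add_left, inner_add_right, inner_sub_left, inner_sub_right,
    real_inner_smul_left, real_inner_smul_right, E.inner_proj_comm a z]
  ring

/-- Since `E_b E_a = E_{min a b}`, replacing `z` by `E_a z` cuts `d⟪E_λ x, z⟫` off at `a`. -/
theorem spectralMeasure_add_proj (a : ℝ) (x z : H) :
    E.spectralMeasure (x + E.proj a z) + (E.spectralMeasure (x - z)).restrict (Iic a)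
      = E.spectralMeasure (x - E.proj a z) + (E.spectralMeasure (x + z)).restrict (Iic a) := by
  refine measure_eq_of_real_Iic fun b => ?_
  simp only [real_add_apply, measureReal_restrict_apply measurableSet_Iic,
    Iic_inter_Iic, spectralMeasure_real_Iic, inf_comm b a,
    map_add, map_sub, inner_add_left, inner_add_right, inner_sub_left, inner_sub_right,
    E.inner_proj_comm _ z, E.inner_proj_comm _ (E.proj a z)]
  have h : inner ℝ (E.proj b x) (E.proj a z) = inner ℝ (E.proj (a ⊓ b) x) z := by
    rw [← E.symm, E.proj_proj]
  rw [h]; ring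

/-- The bilinear form `∫ φ(λ) d⟪E_λ x, z⟫`. -/
def polar (φ : ℝ → ℝ) (x z : H) : ℝ :=
  ((∫ a, φ a ∂(E.spectralMeasure (x + z))) - ∫ a, φ a ∂(E.spectralMeasure (x - z))) / 4

theorem polar_comm (φ : ℝ → ℝ) (x z : H) : E.polar φ x z = E.polar φ z x := by
  rw [polar, polar, add_comm, ← neg_sub z x, spectralMeasure_neg]

theorem polar_self (φ : ℝ → ℝ) (x : H) : E.polar φ x x = ∫ a, φ a ∂(E.spectralMeasure x) := by
  have h : x + x = (2 : ℝ) • x := by rw [two_smul]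
  rw [polar, sub_self, spectralMeasure_zero, h, spectralMeasure_smul, integral_smul_measure]
  simp only [integral_zero_measure, smul_eq_mul, ENNReal.toReal_ofReal (sq_nonneg (2 : ℝ))]
  ring

variable {φ ψ : ℝ → ℝ}

theorem polar_add_left (h : BddMeas φ) (x x' z : H) :
    E.polar φ (x + x') z = E.polar φ x z + E.polar φ x' z := by
  have key := congrArg (fun ν => ∫ a, φ a ∂ν) (E.spectralMeasure_add_add x x' z)
  have I := fun y => h.integrable (E.spectralMeasure y)
  simp only [integral_add_measure ((I _).add_measure (I _)) (I _),
    integral_add_measure (I _) (I _)] at key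
  simp only [polar]; linarith

theorem polar_neg_left (φ : ℝ → ℝ) (x z : H) : E.polar φ (-x) z = -E.polar φ x z := by
  have h1 : -x + z = -(x - z) := by abel
  have h2 : -x - z = -(x + z) := by abel
  rw [polar, polar, h1, h2, spectralMeasure_neg, spectralMeasure_neg]; ring

theorem polar_smul_left (h : BddMeas φ) (c : ℝ) (x z : H) :
    E.polar φ (c • x) z = c * E.polar φ x z := by
  have pos : ∀ c : ℝ, 0 ≤ c → E.polar φ (c • x) z = c * E.polar φ x z := fun c hc => by
    have key := congrArg (fun ν => ∫ a, φ a ∂ν) (E.spectralMeasure_smul_add hc x z)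
    have I := fun y => h.integrable (E.spectralMeasure y)
    have J := fun y => (I y).smul_measure (ENNReal.ofReal_ne_top (r := c))
    simp only [integral_add_measure (I _) (J _), integral_smul_measure,
      ENNReal.toReal_ofReal hc, smul_eq_mul] at key
    simp only [polar]; linarith
  rcases le_total 0 c with hc | hc
  · exact pos c hc
  · have := pos (-c) (by linarith)
    rw [neg_smul, polar_neg_left] at this
    linarith

theorem abs_integral_le {M : ℝ} (hM : ∀ a, |φ a| ≤ M) (x : H) :
    |∫ a, φ a ∂(E.spectralMeasure x)| ≤ M * ‖x‖ ^ 2 := by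
  have := norm_integral_le_of_norm_le_const (μ := E.spectralMeasure x) (f := φ) (Eventually.of_forall hM)
  rwa [spectralMeasure_real_univ] at this

theorem abs_polar_le (h : BddMeas φ) {M : ℝ} (hM : ∀ a, |φ a| ≤ M) (x z : H) :
    |E.polar φ x z| ≤ M * ‖x‖ * ‖z‖ := by
  have hM0 : 0 ≤ M := (abs_nonneg _).trans (hM 0)
  have key : ∀ x z : H, |E.polar φ x z| ≤ M * ((‖x‖ ^ 2 + ‖z‖ ^ 2) / 2) := fun x z => by
    have h1 := abs_le.1 (E.abs_integral_le hM (x + z))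
    have h2 := abs_le.1 (E.abs_integral_le hM (x - z))
    have h3 := parallelogram_law_with_norm ℝ x z
    have h4 : M * ‖x + z‖ ^ 2 + M * ‖x - z‖ ^ 2 = M * (2 * (‖x‖ ^ 2 + ‖z‖ ^ 2)) := by
      rw [← mul_add, h3]
    rw [polar, abs_le]
    constructor <;> linarith
  rcases eq_or_ne x 0 with rfl | hx
  · simp [polar, spectralMeasure_neg]
  rcases eq_or_ne z 0 with rfl | hz
  · simp [polar]
  have hx' := norm_pos_iff.2 hx
  have hz' := norm_pos_iff.2 hz
  -- On unit vectors the bound by half the sum of squares becomes `M`; homogeneity turns it into the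
  -- product bound.
  have k := key ((‖x‖)⁻¹ • x) ((‖z‖)⁻¹ • z)
  rw [E.polar_smul_left h, E.polar_comm, E.polar_smul_left h, E.polar_comm, norm_smul, norm_smul,
    norm_inv, norm_inv, norm_norm, norm_norm, inv_mul_cancel₀ hx'.ne', inv_mul_cancel₀ hz'.ne',
    abs_mul, abs_mul, abs_inv, abs_inv, abs_norm, abs_norm] at k
  norm_num at k
  rw [inv_mul_le_iff₀ hx', inv_mul_le_iff₀ hz'] at k
  linarith

/-- By the parallelogram law the spectral measure of `x + z` is at most twice the sum of those of
`x` and `z`. -/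
theorem memLp_add {x z : H} (hx : MemLp ψ 2 (E.spectralMeasure x))
    (hz : MemLp ψ 2 (E.spectralMeasure z)) : MemLp ψ 2 (E.spectralMeasure (x + z)) := by
  have h : MemLp ψ 2 (ENNReal.ofReal 2 • E.spectralMeasure x + ENNReal.ofReal 2 • E.spectralMeasure z) :=
    ((memLp_two_iff_integrable_sq ((hx.smul_measure ENNReal.ofReal_ne_top).1.add_measure
      (hz.smul_measure ENNReal.ofReal_ne_top).1)).2
      (((memLp_two_iff_integrable_sq hx.1).1 hx |>.smul_measure ENNReal.ofReal_ne_top).add_measure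
        ((memLp_two_iff_integrable_sq hz.1).1 hz |>.smul_measure ENNReal.ofReal_ne_top)))
  rw [← spectralMeasure_parallelogram] at h
  exact h.left_of_add_measure

theorem memLp_neg {x : H} (hx : MemLp ψ 2 (E.spectralMeasure x)) :
    MemLp ψ 2 (E.spectralMeasure (-x)) := by
  rwa [spectralMeasure_neg]

section Complete

variable [CompleteSpace H]

theorem exists_fc (h : BddMeas φ) :
    ∃ F : H →L[ℝ] H, ∀ x z, inner ℝ (F x) z = E.polar φ x z := by
  obtain ⟨M, hM⟩ := h.bdd
  let B : H →ₗ[ℝ] H →ₗ[ℝ] ℝ := LinearMap.mk₂ ℝ (E.polar φ)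
    (E.polar_add_left h) (E.polar_smul_left h)
    (fun x y z => by
      rw [E.polar_comm, E.polar_add_left h, E.polar_comm φ y, E.polar_comm φ z])
    (fun c x y => by rw [E.polar_comm, E.polar_smul_left h, E.polar_comm φ y, smul_eq_mul])
  let B' : H →L[ℝ] H →L[ℝ] ℝ := B.mkContinuous₂ M fun x z => E.abs_polar_le h hM x z
  refine ⟨InnerProductSpace.continuousLinearMapOfBilin (𝕜 := ℝ) B', fun x z => ?_⟩
  rw [InnerProductSpace.continuousLinearMapOfBilin_apply]
  rfl

open Classical in
/-- The operator `∫ φ(λ) dE_λ` for bounded Borel `φ`. -/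
def fc (φ : ℝ → ℝ) : H →L[ℝ] H :=
  if h : BddMeas φ then (E.exists_fc h).choose else 0

theorem inner_fc (h : BddMeas φ) (x z : H) : inner ℝ (E.fc φ x) z = E.polar φ x z := by
  rw [fc, dif_pos h]
  exact (E.exists_fc h).choose_spec x z

theorem fc_symm (h : BddMeas φ) (x z : H) :
    inner ℝ (E.fc φ x) z = inner ℝ x (E.fc φ z) := by
  rw [E.inner_fc h, E.polar_comm, ← E.inner_fc h, real_inner_comm]

theorem norm_fc_le (h : BddMeas φ) {M : ℝ} (hM : ∀ a, |φ a| ≤ M) (x : H) :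
    ‖E.fc φ x‖ ≤ M * ‖x‖ := by
  have h1 := (le_abs_self _).trans (E.abs_polar_le h hM x (E.fc φ x))
  rw [← E.inner_fc h, real_inner_self_eq_norm_mul_norm] at h1
  rcases (norm_nonneg (E.fc φ x)).eq_or_lt with h0 | h0
  · rw [← h0]; exact mul_nonneg ((abs_nonneg _).trans (hM 0)) (norm_nonneg _)
  · exact le_of_mul_le_mul_right h1 h0

theorem inner_fc_proj (h : BddMeas φ) (a : ℝ) (x z : H) :
    inner ℝ (E.fc φ x) (E.proj a z) = E.polar ((Iic a).indicator φ) x z := by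
  have key := congrArg (fun ν => ∫ a, φ a ∂ν) (E.spectralMeasure_add_proj a x z)
  have I := fun y => h.integrable (E.spectralMeasure y)
  simp only [integral_add_measure (I _) ((I _).restrict)] at key
  rw [E.inner_fc h, polar, polar, integral_indicator measurableSet_Iic,
    integral_indicator measurableSet_Iic]
  linarith

/-- `dE_λ (∫ φ dE) = φ(λ) dE_λ`. -/
theorem spectralMeasure_fc_add (h : BddMeas φ) (h0 : ∀ a, 0 ≤ φ a) (x z : H) :
    E.spectralMeasure (E.fc φ x + z) + weighted φ (E.spectralMeasure (x - z))
      = E.spectralMeasure (E.fc φ x - z) + weighted φ (E.spectralMeasure (x + z)) := by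
  have := isFiniteMeasure_weighted (ν := E.spectralMeasure (x - z)) h
  have := isFiniteMeasure_weighted (ν := E.spectralMeasure (x + z)) h
  refine measure_eq_of_real_Iic fun a => ?_
  have k := E.inner_fc_proj h a x z
  rw [polar] at k
  simp only [real_add_apply, spectralMeasure_real_Iic, weighted_real_Iic h h0,
    map_add, map_sub, inner_add_left, inner_add_right, inner_sub_left, inner_sub_right,
    E.inner_proj_comm a z]
  rw [← E.symm] at k
  linarith

/-- With `F = fc φ`, `‖E_a F x‖²` is the integral of `φ` over `(-∞, a]` against `d⟪E_λ x, F x⟫`,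
which is itself `φ d‖E_λ x‖²`; hence the density `φ²`. -/
theorem spectralMeasure_fc (h : BddMeas φ) (h0 : ∀ a, 0 ≤ φ a) (x : H) :
    E.spectralMeasure (E.fc φ x) = weighted φ (weighted φ (E.spectralMeasure x)) := by
  have := fun y => isFiniteMeasure_weighted (ν := E.spectralMeasure y) h
  have := fun y => isFiniteMeasure_weighted (ν := weighted φ (E.spectralMeasure y)) h
  refine measure_eq_of_real_Iic fun a => ?_
  have hi := h.indicator (measurableSet_Iic (a := a))
  have k := E.inner_fc_proj h a x (E.fc φ x)
  -- Taking `z = x` leaves the measures of `0` and `2x`, that is `0` and `4 d‖E_λ x‖²`.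
  have l := congrArg (fun ν => ∫ b, (Iic a).indicator φ b ∂ν) (E.spectralMeasure_fc_add h h0 x x)
  have I := fun y => hi.integrable (E.spectralMeasure y)
  have J := fun y => hi.integrable (weighted φ (E.spectralMeasure y))
  have hx : x + x = (2 : ℝ) • x := by rw [two_smul]
  have w0 : weighted φ 0 = 0 := by simp [weighted]
  have w2 : weighted φ (ENNReal.ofReal (2 ^ 2) • E.spectralMeasure x)
      = ENNReal.ofReal (2 ^ 2) • weighted φ (E.spectralMeasure x) := by
    rw [weighted, weighted, withDensity_smul_measure]
  simp only [sub_self, hx, spectralMeasure_smul,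
    spectralMeasure_zero, w0, w2] at l
  rw [add_zero, integral_add_measure (I _) ((J _).smul_measure ENNReal.ofReal_ne_top),
    integral_smul_measure, ENNReal.toReal_ofReal (by positivity)] at l
  rw [weighted_real_Iic h h0, spectralMeasure_real_Iic, E.symm, k, E.polar_comm, polar]
  rw [smul_eq_mul] at l
  linarith

theorem memLp_fc (h : BddMeas φ) (h0 : ∀ a, 0 ≤ φ a) (hψ : Measurable ψ)
    (hb : BddMeas (fun a => φ a * ψ a)) (x : H) : MemLp ψ 2 (E.spectralMeasure (E.fc φ x)) := by
  have := isFiniteMeasure_weighted (ν := E.spectralMeasure x) h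
  rw [memLp_two_iff_integrable_sq hψ.aestronglyMeasurable, E.spectralMeasure_fc h h0,
    integrable_weighted h.measurable h0, integrable_weighted h.measurable h0]
  refine ((hb.mul hb).integrable _).congr (Eventually.of_forall fun a => ?_)
  simp only; ring

theorem polar_fc (h : BddMeas φ) (h0 : ∀ a, 0 ≤ φ a) (hψ : Measurable ψ)
    (hb : BddMeas (fun a => φ a * ψ a)) (x z : H) (hz : MemLp ψ 2 (E.spectralMeasure z)) :
    E.polar ψ (E.fc φ x) z = E.polar (fun a => φ a * ψ a) x z := by
  have key := congrArg (fun ν => ∫ a, ψ a ∂ν) (E.spectralMeasure_fc_add h h0 x z)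
  have hx := E.memLp_fc h h0 hψ hb x
  have I1 := (E.memLp_add hx hz).integrable (by simp)
  have I2 := (E.memLp_add hx (E.memLp_neg hz)).integrable (by simp)
  rw [← sub_eq_add_neg] at I2
  have J := fun y => (integrable_weighted (ψ := ψ) (ν := E.spectralMeasure y) h.measurable h0).2
    (hb.integrable _)
  simp only [integral_add_measure I1 (J _), integral_add_measure I2 (J _),
    integral_weighted h.measurable h0] at key
  rw [polar, polar]; linarith

theorem hasIntegral_fc (h : BddMeas φ) (x : H) : E.HasIntegral φ x (E.fc φ x) :=
  ⟨h.memLp _, fun z _ => E.inner_fc h x z⟩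

/-- Multiplicativity of the calculus with `ψ` allowed to be unbounded: the factor `φ` absorbs its
growth. This puts smoothed vectors in the domain of `∫ λ dE_λ`. -/
theorem hasIntegral_fc_mul (h : BddMeas φ) (h0 : ∀ a, 0 ≤ φ a) (hψ : Measurable ψ)
    (hb : BddMeas (fun a => φ a * ψ a)) (x : H) :
    E.HasIntegral ψ (E.fc φ x) (E.fc (fun a => φ a * ψ a) x) :=
  ⟨E.memLp_fc h h0 hψ hb x, fun z hz => by
    rw [E.inner_fc hb, ← E.polar_fc h h0 hψ hb x z hz]; rfl⟩

end Complete

theorem hasIntegral_congr (h : ∀ x : H, φ =ᵐ[E.spectralMeasure x] ψ) {x y : H} :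
    E.HasIntegral φ x y ↔ E.HasIntegral ψ x y := by
  have hI : ∀ x : H, ∫ a, φ a ∂(E.spectralMeasure x) = ∫ a, ψ a ∂(E.spectralMeasure x) :=
    fun x => integral_congr_ae (h x)
  simp only [HasIntegral, memLp_congr_ae (h _), hI]

end ResolutionOfIdentity

end

/-! ### Resolutions of nonnegative operators -/

section

open Set

namespace ResolutionOfIdentity

variable {H : Type*} [NormedAddCommGroup H] [InnerProductSpace ℝ H] (E : ResolutionOfIdentity H)

/-- The resolution of the identity of a nonnegative operator: `E_λ = 0` for `λ < 0`. -/
def Nonneg : Prop := ∀ a < 0, ∀ x, E.proj a x = 0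

variable {E}

theorem Nonneg.ae_nonneg (h : E.Nonneg) (x : H) : ∀ᵐ a ∂(E.spectralMeasure x), 0 ≤ a := by
  have hU : {a : ℝ | ¬ 0 ≤ a} ⊆ ⋃ n : ℕ, Iic (-(1 / ((n : ℝ) + 1))) := fun a ha => by
    obtain ⟨n, hn⟩ := exists_nat_one_div_lt (show 0 < -a by simpa using ha)
    exact mem_iUnion.2 ⟨n, by simp only [mem_Iic]; linarith⟩
  refine measure_mono_null hU (measure_iUnion_null fun n => ?_)
  rw [spectralMeasure_Iic, h _ (neg_lt_zero.2 (by positivity))]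
  simp

theorem Nonneg.max_ae_eq (h : E.Nonneg) (x : H) :
    (fun a => max a 0) =ᵐ[E.spectralMeasure x] fun a => a := by
  filter_upwards [h.ae_nonneg x] with a ha using max_eq_left ha

theorem spectralMeasure_real_Ioc (x : H) {b c : ℝ} (hbc : b ≤ c) :
    (E.spectralMeasure x).real (Ioc b c)
      = inner ℝ (E.proj c x) x - inner ℝ (E.proj b x) x := by
  rw [← spectralMeasure_real_Iic, ← spectralMeasure_real_Iic, ← Iic_sdiff_Iic,
    measureReal_sdiff (Iic_subset_Iic.2 hbc) measurableSet_Iic]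

variable [CompleteSpace H]

theorem integral_fc {φ : ℝ → ℝ} (h : BddMeas φ) (h0 : ∀ a, 0 ≤ φ a) (ψ : ℝ → ℝ) (x : H) :
    ∫ a, ψ a ∂(E.spectralMeasure (E.fc φ x)) = ∫ a, φ a * (φ a * ψ a) ∂(E.spectralMeasure x) := by
  rw [E.spectralMeasure_fc h h0, integral_weighted h.measurable h0,
    integral_weighted h.measurable h0]

/-- For `b < c < 0` let `y` be the component of `x` in the spectral window `(b, c]`. Then `0 ≤ ⟪T y,
y⟫ ≤ c ‖y‖²`, so the window has no mass; let `b → -∞`. -/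
theorem IsSpectralResolution.nonneg {T : H →ₗ.[ℝ] H} (hE : E.IsSpectralResolution T)
    (hT : ∀ x y, (x, y) ∈ T.graph → 0 ≤ inner ℝ y x) : E.Nonneg := by
  intro c hc x
  have hb : ∀ b < c, (E.spectralMeasure x).real (Ioc b c) = 0 := fun b hbc => by
    have hφ : BddMeas ((Ioc b c).indicator fun _ => (1 : ℝ)) :=
      (BddMeas.const 1).indicator measurableSet_Ioc
    have h0 : ∀ a, 0 ≤ (Ioc b c).indicator (fun _ => (1 : ℝ)) a :=
      fun a => indicator_nonneg (fun _ _ => zero_le_one) a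
    have hb : BddMeas fun a => (Ioc b c).indicator (fun _ => (1 : ℝ)) a * a := by
      refine ⟨hφ.measurable.mul measurable_id, max |b| |c|, fun a => ?_⟩
      by_cases ha : a ∈ Ioc b c
      · simpa [ha] using abs_le_max_abs_abs ha.1.le ha.2
      · simp [ha]
    have hI := E.hasIntegral_fc_mul hφ h0 measurable_id hb x
    have hn := hT _ _ ((hE _ _).2 hI)
    have hp : _ = E.polar id _ _ := hI.2 _ hI.1
    rw [hp, polar_self, integral_fc hφ h0] at hn
    have hle : ∫ a, (Ioc b c).indicator (fun _ => (1 : ℝ)) a *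
        ((Ioc b c).indicator (fun _ => (1 : ℝ)) a * id a) ∂(E.spectralMeasure x)
        ≤ ∫ a, (Ioc b c).indicator (fun _ => c) a ∂(E.spectralMeasure x) := by
      refine integral_mono ((hφ.mul hb).integrable _)
        (((BddMeas.const c).indicator measurableSet_Ioc).integrable _) fun a => ?_
      by_cases ha : a ∈ Ioc b c
      · simpa [ha] using ha.2
      · simp [ha]
    rw [integral_indicator_const _ measurableSet_Ioc, smul_eq_mul] at hle
    have := measureReal_nonneg (μ := E.spectralMeasure x) (s := Ioc b c)
    nlinarith
  have hlim : Tendsto (fun b => inner ℝ (E.proj b x) x) atBot (𝓝 0) := by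
    simpa using (E.tendsto_atBot x).inner tendsto_const_nhds (𝕜 := ℝ) (g := fun _ => x)
  have hconst : Tendsto (fun b => inner ℝ (E.proj b x) x) atBot (𝓝 (inner ℝ (E.proj c x) x)) := by
    refine tendsto_const_nhds.congr' ?_
    filter_upwards [eventually_lt_atBot c] with b hbc
    have := spectralMeasure_real_Ioc (E := E) x hbc.le
    rw [hb b hbc] at this
    linarith
  have h0 := tendsto_nhds_unique hconst hlim
  rw [← norm_proj_sq] at h0
  simpa using h0

/-! ### The resolvent -/

/-- The function `1 / (1 + λ)` on the half-line. -/
def resolventFun (a : ℝ) : ℝ := (1 + max a 0)⁻¹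

theorem resolventFun_nonneg (a : ℝ) : 0 ≤ resolventFun a := by
  unfold resolventFun; positivity

theorem resolventFun_le_one (a : ℝ) : resolventFun a ≤ 1 :=
  inv_le_one_of_one_le₀ (by simp)

theorem bddMeas_resolventFun : BddMeas resolventFun :=
  ⟨by unfold resolventFun; fun_prop, 1, fun a => by
    rw [abs_of_nonneg (resolventFun_nonneg a)]; exact resolventFun_le_one a⟩

theorem resolventFun_mul_max (a : ℝ) : resolventFun a * max a 0 = 1 - resolventFun a := by
  have : 0 < 1 + max a 0 := by positivity
  unfold resolventFun
  field_simp
  ring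

theorem bddMeas_resolventFun_mul : BddMeas fun a => resolventFun a * max a 0 :=
  ⟨by have := bddMeas_resolventFun.measurable; fun_prop, 1, fun a => by
    rw [resolventFun_mul_max, abs_of_nonneg] <;>
    linarith [resolventFun_le_one a, resolventFun_nonneg a]⟩

theorem fc_resolventFun_mul (x : H) :
    E.fc (fun a => resolventFun a * max a 0) x = x - E.fc resolventFun x := by
  refine ext_inner_right ℝ fun z => ?_
  have hI := fun y => bddMeas_resolventFun.integrable (E.spectralMeasure y)
  rw [inner_sub_left, E.inner_fc bddMeas_resolventFun_mul, E.inner_fc bddMeas_resolventFun,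
    polar, polar]
  simp only [resolventFun_mul_max]
  rw [integral_sub (integrable_const _) (hI _), integral_sub (integrable_const _) (hI _)]
  simp only [integral_const, spectralMeasure_real_univ, smul_eq_mul, mul_one]
  have h1 := norm_add_sq_real x z
  have h2 := norm_sub_sq_real x z
  linarith

theorem Nonneg.hasIntegral_resolvent (h : E.Nonneg) (w : H) :
    E.HasIntegral (fun a => a) (E.fc resolventFun w) (w - E.fc resolventFun w) := by
  rw [← E.hasIntegral_congr h.max_ae_eq, ← fc_resolventFun_mul]
  exact E.hasIntegral_fc_mul bddMeas_resolventFun resolventFun_nonneg (by fun_prop)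
    bddMeas_resolventFun_mul w

/-- The unbounded operator `∫ λ dE_λ` is encoded by its bounded resolvent. Forwards, its symmetry is
tested against the vectors `fc resolventFun w`, which lie in the domain for every `w`. -/
theorem Nonneg.hasIntegral_id_iff (h : E.Nonneg) (x y : H) :
    E.HasIntegral (fun a => a) x y ↔ x = E.fc resolventFun (x + y) := by
  constructor
  · intro hI
    refine ext_inner_right ℝ fun w => ?_
    have hz := h.hasIntegral_resolvent w
    have h1 : inner ℝ y _ = E.polar _ _ _ := hI.2 _ hz.1
    have h2 : inner ℝ _ x = E.polar _ _ _ := hz.2 _ hI.1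
    rw [polar_comm, ← h1, inner_sub_left, real_inner_comm x w,
      real_inner_comm x (E.fc resolventFun w)] at h2
    rw [E.fc_symm bddMeas_resolventFun, inner_add_left]
    linarith
  · intro hx
    have := h.hasIntegral_resolvent (x + y)
    rwa [← hx, add_sub_cancel_left] at this

/-! ### The heat semigroup -/

/-- The function `λʲ e^{-tλ}` on the half-line. -/
def heatFun (t : ℝ) (j : ℕ) (a : ℝ) : ℝ := (max a 0) ^ j * Real.exp (-(t * max a 0))

theorem heatFun_nonneg (t : ℝ) (j : ℕ) (a : ℝ) : 0 ≤ heatFun t j a := by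
  unfold heatFun; positivity

theorem abs_heatFun_le {t : ℝ} (ht : 0 < t) (j : ℕ) (a : ℝ) :
    |heatFun t j a| ≤ j.factorial * (t ^ j)⁻¹ := by
  have hs : 0 ≤ max a 0 := le_max_right _ _
  rw [abs_of_nonneg (heatFun_nonneg t j a), heatFun, Real.exp_neg, ← div_eq_mul_inv,
    ← div_eq_mul_inv, div_le_div_iff₀ (Real.exp_pos _) (by positivity), ← mul_pow]
  have := Real.pow_div_factorial_le_exp (t * max a 0) (by positivity) j
  rw [div_le_iff₀ (by positivity)] at this
  rw [mul_comm (max a 0)]; linarith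

theorem bddMeas_heatFun {t : ℝ} (ht : 0 < t) (j : ℕ) : BddMeas (heatFun t j) :=
  ⟨by unfold heatFun; fun_prop, _, abs_heatFun_le ht j⟩

theorem heatFun_mul_max (t : ℝ) (j : ℕ) :
    (fun a => heatFun t j a * max a 0) = heatFun t (j + 1) := by
  ext a; simp only [heatFun, pow_succ]; ring

theorem Nonneg.hasIntegral_heat (h : E.Nonneg) {t : ℝ} (ht : 0 < t) (x : H) :
    E.HasIntegral (fun a => Real.exp (-(t * a))) x (E.fc (heatFun t 0) x) := by
  rw [← E.hasIntegral_congr (φ := heatFun t 0)]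
  · exact E.hasIntegral_fc (bddMeas_heatFun ht 0) x
  · intro z
    filter_upwards [h.ae_nonneg z] with a ha
    simp [heatFun, ha]

theorem Nonneg.hasIntegral_heatFun_succ (h : E.Nonneg) {t : ℝ} (ht : 0 < t) (j : ℕ) (x : H) :
    E.HasIntegral (fun a => a) (E.fc (heatFun t j) x) (E.fc (heatFun t (j + 1)) x) := by
  rw [← E.hasIntegral_congr h.max_ae_eq, ← heatFun_mul_max]
  refine E.hasIntegral_fc_mul (bddMeas_heatFun ht j) (heatFun_nonneg t j) (by fun_prop) ?_ x
  rw [heatFun_mul_max]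
  exact bddMeas_heatFun ht (j + 1)

variable {T : H →ₗ.[ℝ] H}

theorem IsSpectralResolution.heat_mem (hE : E.IsSpectralResolution T) (h : E.Nonneg) {t : ℝ}
    (ht : 0 < t) (j : ℕ) (x : H) : E.fc (heatFun t j) x ∈ T.domain :=
  LinearPMap.mem_domain_of_mem_graph ((hE _ _).2 (h.hasIntegral_heatFun_succ ht j x))

theorem IsSpectralResolution.value_heat (hE : E.IsSpectralResolution T) (h : E.Nonneg) {t : ℝ}
    (ht : 0 < t) (j : ℕ) (x : H) :
    value T (E.fc (heatFun t j) x) = E.fc (heatFun t (j + 1)) x := by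
  have hm := hE.heat_mem h ht j x
  rw [value, dif_pos hm]
  exact (LinearPMap.image_iff hm).2 ((hE _ _).2 (h.hasIntegral_heatFun_succ ht j x)) |>.symm

theorem IsSpectralResolution.iterate_value_heat (hE : E.IsSpectralResolution T) (h : E.Nonneg)
    {t : ℝ} (ht : 0 < t) (j : ℕ) (x : H) :
    (value T)^[j] (E.fc (heatFun t 0) x) = E.fc (heatFun t j) x := by
  induction j with
  | zero => rfl
  | succ j ih => rw [Function.iterate_succ_apply', ih, hE.value_heat h ht]

theorem IsSpectralResolution.memDomPow_heat (hE : E.IsSpectralResolution T) (h : E.Nonneg)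
    {t : ℝ} (ht : 0 < t) (k : ℕ) (x : H) : MemDomPow T k (E.fc (heatFun t 0) x) := fun j _ => by
  rw [hE.iterate_value_heat h ht]
  exact hE.heat_mem h ht j x

/-- For `t ≥ 1` the constant dominates, for `t ≤ 1` the highest inverse power does. -/
theorem inv_pow_le_one_add {t : ℝ} (ht : 0 < t) {i m : ℕ} (him : i ≤ m) :
    (t ^ i)⁻¹ ≤ 1 + (t ^ m)⁻¹ := by
  have hm : 0 < (t ^ m)⁻¹ := by positivity
  rcases le_total 1 t with h | h
  · have := inv_le_one_of_one_le₀ (one_le_pow₀ h (n := i))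
    linarith
  · have := inv_anti₀ (by positivity) (pow_le_pow_of_le_one ht.le h him)
    linarith

theorem IsSpectralResolution.sobolevNorm_heat_le (hE : E.IsSpectralResolution T) (h : E.Nonneg)
    {t : ℝ} (ht : 0 < t) (k : ℕ) (x : H) :
    sobolevNorm T k (E.fc (heatFun t 0) x)
      ≤ ((2 * k + 1 : ℕ) * k.factorial) * (1 + (t ^ k)⁻¹) * ‖x‖ := by
  have hs : 0 < (t ^ k)⁻¹ := by positivity
  set s := (t ^ k)⁻¹ with hsdef
  have hterm : ∀ I ∈ Finset.range (2 * k + 1),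
      inner ℝ ((value T)^[I / 2] (E.fc (heatFun t 0) x))
        ((value T)^[I - I / 2] (E.fc (heatFun t 0) x))
      ≤ (k.factorial : ℝ) ^ 2 * (1 + s ^ 2) * ‖x‖ ^ 2 := fun I hI => by
    have hI' : I ≤ 2 * k := by have := Finset.mem_range.1 hI; omega
    rw [hE.iterate_value_heat h ht, hE.iterate_value_heat h ht]
    have hf : ∀ j ≤ k, ‖E.fc (heatFun t j) x‖ ≤ k.factorial * (t ^ j)⁻¹ * ‖x‖ := fun j hj => by
      refine (E.norm_fc_le (bddMeas_heatFun ht j) (abs_heatFun_le ht j) x).trans ?_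
      gcongr
    have hpow : (t ^ (I / 2))⁻¹ * (t ^ (I - I / 2))⁻¹ ≤ 1 + s ^ 2 := by
      rw [← mul_inv, ← pow_add, hsdef, inv_pow, ← pow_mul, mul_comm k 2]
      exact inv_pow_le_one_add ht (by omega)
    calc _ ≤ ‖E.fc (heatFun t (I / 2)) x‖ * ‖E.fc (heatFun t (I - I / 2)) x‖ :=
          real_inner_le_norm _ _
      _ ≤ (k.factorial * (t ^ (I / 2))⁻¹ * ‖x‖) * (k.factorial * (t ^ (I - I / 2))⁻¹ * ‖x‖) :=
          mul_le_mul (hf _ (by omega)) (hf _ (by omega)) (norm_nonneg _) (by positivity)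
      _ = (k.factorial : ℝ) ^ 2 * ((t ^ (I / 2))⁻¹ * (t ^ (I - I / 2))⁻¹) * ‖x‖ ^ 2 := by ring
      _ ≤ _ := by gcongr
  refine Real.sqrt_le_iff.2 ⟨by positivity, (Finset.sum_le_card_nsmul _ _ _ hterm).trans ?_⟩
  rw [Finset.card_range, nsmul_eq_mul]
  have h1 : (1 : ℝ) ≤ (2 * k + 1 : ℕ) := by exact_mod_cast Nat.le_add_left 1 (2 * k)
  -- Enlarged to a perfect square, using `2k + 1 ≤ (2k + 1)²` and `1 + s² ≤ (1 + s)²`.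
  calc ((2 * k + 1 : ℕ) : ℝ) * ((k.factorial : ℝ) ^ 2 * (1 + s ^ 2) * ‖x‖ ^ 2)
      ≤ ((2 * k + 1 : ℕ) : ℝ) ^ 2 * ((k.factorial : ℝ) ^ 2 * (1 + s) ^ 2 * ‖x‖ ^ 2) := by
        gcongr
        · exact le_self_pow₀ h1 two_ne_zero
        · nlinarith
    _ = _ := by ring

end ResolutionOfIdentity

end

section

/-! ### Square roots and absolute values of bounded operators -/

/-- The coefficients of `1 - √(1 - z) = ∑ cₖ zᵏ⁺¹`. -/
def sqrtCoeff (k : ℕ) : ℝ := catalan k / 2 ^ (2 * k + 1)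

theorem sqrtCoeff_nonneg (k : ℕ) : 0 ≤ sqrtCoeff k := by unfold sqrtCoeff; positivity

/-- The closed form bounds the partial sums by `1`, so the square root series converges up to the
boundary case `‖B‖ = 1`. -/
theorem sum_range_sqrtCoeff (n : ℕ) :
    ∑ k ∈ Finset.range n, sqrtCoeff k = 1 - n.centralBinom / 4 ^ n := by
  induction n with
  | zero => simp
  | succ n ih =>
    have h1 : ((n + 1 : ℕ) : ℝ) * catalan n = n.centralBinom := by
      exact_mod_cast succ_mul_catalan_eq_centralBinom n
    have h2 : ((n + 1 : ℕ) : ℝ) * (n + 1).centralBinom = 2 * (2 * n + 1) * n.centralBinom := by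
      exact_mod_cast Nat.succ_mul_centralBinom_succ n
    have hn : ((n + 1 : ℕ) : ℝ) ≠ 0 := by positivity
    have h3 : (n + 1).centralBinom = 2 * (2 * n + 1) * (catalan n : ℝ) := by
      apply mul_left_cancel₀ hn
      rw [h2, ← h1]; ring
    rw [Finset.sum_range_succ, ih, sqrtCoeff, h3, ← h1]
    have : (2 : ℝ) ^ (2 * n + 1) = 2 * 4 ^ n := by rw [pow_succ, pow_mul]; norm_num; ring
    rw [this, pow_succ]
    push_cast
    field_simp
    ring

theorem sum_range_sqrtCoeff_le (n : ℕ) : ∑ k ∈ Finset.range n, sqrtCoeff k ≤ 1 := by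
  rw [sum_range_sqrtCoeff]
  have : (0 : ℝ) ≤ n.centralBinom / 4 ^ n := by positivity
  linarith

theorem summable_sqrtCoeff : Summable sqrtCoeff :=
  summable_of_sum_range_le sqrtCoeff_nonneg sum_range_sqrtCoeff_le

theorem tsum_sqrtCoeff_le : ∑' k, sqrtCoeff k ≤ 1 :=
  Real.tsum_le_of_sum_range_le sqrtCoeff_nonneg sum_range_sqrtCoeff_le

/-- The Catalan recursion, which is the coefficient form of `S² = 2 S - B`, that is `(1 - S)² = 1 -
B`. -/
theorem sum_antidiagonal_sqrtCoeff (n : ℕ) :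
    ∑ p ∈ Finset.HasAntidiagonal.antidiagonal n, sqrtCoeff p.1 * sqrtCoeff p.2 = 2 * sqrtCoeff (n + 1) := by
  rw [sqrtCoeff, catalan_succ']
  push_cast
  rw [Finset.sum_div, Finset.mul_sum]
  refine Finset.sum_congr rfl fun p hp => ?_
  rw [← Finset.HasAntidiagonal.mem_antidiagonal.1 hp, sqrtCoeff, sqrtCoeff]
  field_simp
  ring

section Banach

variable {R : Type*} [NormedRing R] [NormedAlgebra ℝ R]

/-- `1 - √(1 - B)`. -/
def oneSubSqrt (B : R) : R := ∑' k, sqrtCoeff k • B ^ (k + 1)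

variable {B : R}

theorem norm_sqrtCoeff_smul_le (hB : ‖B‖ ≤ 1) (k : ℕ) :
    ‖sqrtCoeff k • B ^ (k + 1)‖ ≤ sqrtCoeff k := by
  rw [norm_smul, Real.norm_of_nonneg (sqrtCoeff_nonneg k)]
  refine mul_le_of_le_one_right (sqrtCoeff_nonneg k) ?_
  exact (norm_pow_le' B k.succ_pos).trans (pow_le_one₀ (norm_nonneg _) hB)

theorem summable_norm_oneSubSqrt (hB : ‖B‖ ≤ 1) :
    Summable fun k => ‖sqrtCoeff k • B ^ (k + 1)‖ :=
  summable_sqrtCoeff.of_nonneg_of_le (fun _ => norm_nonneg _) (norm_sqrtCoeff_smul_le hB)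

theorem norm_oneSubSqrt_le (hB : ‖B‖ ≤ 1) : ‖oneSubSqrt B‖ ≤ 1 :=
  (tsum_of_norm_bounded summable_sqrtCoeff.hasSum (norm_sqrtCoeff_smul_le hB)).trans
    tsum_sqrtCoeff_le

theorem oneSubSqrt_mul_self [CompleteSpace R] (hB : ‖B‖ ≤ 1) :
    oneSubSqrt B * oneSubSqrt B = (2 : ℝ) • oneSubSqrt B - B := by
  have hs := summable_norm_oneSubSqrt hB
  have h0 : sqrtCoeff 0 = 1 / 2 := by simp [sqrtCoeff]
  have h1 : oneSubSqrt B = (1 / 2 : ℝ) • B + ∑' k, sqrtCoeff (k + 1) • B ^ (k + 1 + 1) := by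
    rw [oneSubSqrt, hs.of_norm.tsum_eq_zero_add, h0, zero_add, pow_one]
  have h2 : oneSubSqrt B * oneSubSqrt B = ∑' k, (2 : ℝ) • (sqrtCoeff (k + 1) • B ^ (k + 2)) := by
    rw [oneSubSqrt, tsum_mul_tsum_eq_tsum_sum_antidiagonal_of_summable_norm hs hs]
    refine tsum_congr fun n => ?_
    rw [smul_smul, ← sum_antidiagonal_sqrtCoeff, Finset.sum_smul]
    refine Finset.sum_congr rfl fun p hp => ?_
    rw [smul_mul_smul_comm, ← pow_add, ← Finset.HasAntidiagonal.mem_antidiagonal.1 hp]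
    congr 2; ring
  rw [h2, tsum_const_smul'', h1, smul_add, smul_smul]
  norm_num

theorem Commute.oneSubSqrt {C : R} (h : Commute C B) : Commute C (oneSubSqrt B) :=
  Commute.tsum_right C fun k => (h.pow_right (k + 1)).smul_right (sqrtCoeff k)

end Banach

variable {H : Type*} [NormedAddCommGroup H] [InnerProductSpace ℝ H] [CompleteSpace H]

theorem inner_comm_of_isSelfAdjoint {A : H →L[ℝ] H} (hA : IsSelfAdjoint A) (x y : H) :
    inner ℝ (A x) y = inner ℝ x (A y) :=
  hA.isSymmetric x y

theorem isSelfAdjoint_oneSubSqrt {B : H →L[ℝ] H} (h : IsSelfAdjoint B) :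
    IsSelfAdjoint (oneSubSqrt B) := by
  rw [IsSelfAdjoint, oneSubSqrt, tsum_star]
  refine tsum_congr fun k => ?_
  rw [star_smul, star_pow, h.star_eq, star_trivial]

/-- The absolute value of a self-adjoint contraction. -/
theorem exists_abs {A : H →L[ℝ] H} (hA : IsSelfAdjoint A) (h1 : ‖A‖ ≤ 1) :
    ∃ P : H →L[ℝ] H, IsSelfAdjoint P ∧ P * P = A * A ∧ (∀ x, 0 ≤ inner ℝ (P x) x) ∧
      ∀ C, Commute C A → Commute C P := by
  have hle : ∀ x, ‖A x‖ ≤ ‖x‖ := fun x => A.le_of_opNorm_le_of_le h1 le_rfl |>.trans (by simp)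
  -- Here `‖x - A² x‖² = ‖x‖² - 2 ‖A x‖² + ‖A² x‖²`, and `‖A² x‖ ≤ ‖A x‖`.
  have hB : ‖1 - A * A‖ ≤ 1 := by
    refine ContinuousLinearMap.opNorm_le_bound _ zero_le_one fun x => ?_
    rw [one_mul]
    refine le_of_sq_le_sq ?_ (norm_nonneg _)
    have h := norm_sub_sq_real x (A (A x))
    rw [← inner_comm_of_isSelfAdjoint hA, real_inner_self_eq_norm_sq] at h
    have h2 : ‖A (A x)‖ ^ 2 ≤ ‖A x‖ ^ 2 := pow_le_pow_left₀ (norm_nonneg _) (hle _) 2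
    change ‖x - A (A x)‖ ^ 2 ≤ _
    have := sq_nonneg ‖A x‖
    linarith
  refine ⟨1 - oneSubSqrt (1 - A * A), ?_, ?_, fun x => ?_, fun C hC => ?_⟩
  · refine (IsSelfAdjoint.one _).sub (isSelfAdjoint_oneSubSqrt ((IsSelfAdjoint.one _).sub ?_))
    rw [IsSelfAdjoint, star_mul, hA.star_eq]
  · have := oneSubSqrt_mul_self hB
    rw [two_smul] at this
    rw [sub_mul, mul_sub, mul_sub, this]
    simp only [one_mul, mul_one]
    abel
  · have h2 : inner ℝ (oneSubSqrt (1 - A * A) x) x ≤ ‖x‖ * ‖x‖ :=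
      (real_inner_le_norm _ _).trans (mul_le_mul_of_nonneg_right
        (((oneSubSqrt (1 - A * A)).le_of_opNorm_le (norm_oneSubSqrt_le hB) x).trans (by simp))
        (norm_nonneg _))
    change 0 ≤ inner ℝ (x - oneSubSqrt (1 - A * A) x) x
    rw [inner_sub_left, real_inner_self_eq_norm_mul_norm]
    linarith
  · exact (Commute.one_right C).sub_right
      (Commute.oneSubSqrt ((Commute.one_right C).sub_right (hC.mul_right hC)))

/-- The spectral subspace of a self-adjoint operator belonging to `[0, ∞)`. -/
theorem exists_nonneg_subspace {A : H →L[ℝ] H} (hA : IsSelfAdjoint A) :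
    ∃ K : Submodule ℝ H, IsClosed (K : Set H) ∧
      (∀ C : H →L[ℝ] H, Commute C A → ∀ x ∈ K, C x ∈ K) ∧
      (∀ x ∈ K, 0 ≤ inner ℝ (A x) x) ∧ (∀ x ∈ Kᗮ, inner ℝ (A x) x ≤ 0) ∧
      ∀ x, A x = 0 → x ∈ K := by
  -- Scales `A` to a contraction; the `+ 1` covers `A = 0`.
  set c : ℝ := (‖A‖ + 1)⁻¹ with hc
  have hc0 : 0 < c := by positivity
  have hcA : IsSelfAdjoint (c • A) := by
    rw [IsSelfAdjoint, star_smul, hA.star_eq, star_trivial]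
  have hn : ‖c • A‖ ≤ 1 := by
    rw [norm_smul, Real.norm_of_nonneg hc0.le, hc, inv_mul_le_iff₀ (by positivity)]
    linarith
  have hinner : ∀ x, inner ℝ ((c • A) x) x = c * inner ℝ (A x) x := fun x => by
    rw [smul_apply, real_inner_smul_left]
  obtain ⟨P, hP, hPP, hP0, hcomm⟩ := exists_abs hcA hn
  have hPA : Commute P (c • A) := (hcomm _ (Commute.refl _)).symm
  have hmem : ∀ x, x ∈ (P - c • A).ker ↔ P x = (c • A) x := fun x => by
    rw [LinearMap.mem_ker, ContinuousLinearMap.coe_coe, sub_apply, sub_eq_zero]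
  have hinv : ∀ C : H →L[ℝ] H, Commute C (c • A) → ∀ x ∈ (P - c • A).ker,
      C x ∈ (P - c • A).ker := fun C hC x hx => by
    rw [hmem] at hx ⊢
    have h1 : C (P x) = P (C x) := congrArg (fun F => F x) (hcomm C hC).eq
    have h2 : C ((c • A) x) = (c • A) (C x) := congrArg (fun F => F x) hC.eq
    rw [← h1, ← h2, hx]
  refine ⟨(P - c • A).ker, (P - c • A).isClosed_ker,
    fun C hC => hinv C (hC.smul_right c), fun x hx => ?_, fun x hx => ?_, fun x hx => ?_⟩
  · have := hP0 x
    rw [(hmem x).1 hx, hinner] at this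
    exact nonneg_of_mul_nonneg_right this hc0
  · have hsum : IsSelfAdjoint (P + c • A) := hP.add hcA
    -- The range of `P + cA` therefore lies in the kernel of `P - cA`, so a vector orthogonal to
    -- that kernel is killed by `P + cA`, and there `cA = -P ≤ 0`.
    have hmul : (P - c • A) * (P + c • A) = 0 := by
      rw [sub_mul, mul_add, mul_add, hPP, hPA.eq]
      abel
    have hk : ∀ y, (P + c • A) y ∈ (P - c • A).ker := fun y => by
      rw [LinearMap.mem_ker]
      exact congrArg (fun F => F y) hmul
    have h0 : (P + c • A) x = 0 := by
      rw [← inner_self_eq_zero (𝕜 := ℝ), inner_comm_of_isSelfAdjoint hsum, real_inner_comm]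
      exact hx _ (hk _)
    have h1 : (c • A) x = -P x := by
      rw [add_apply] at h0
      exact eq_neg_of_add_eq_zero_right h0
    have h2 := hinner x
    rw [h1, inner_neg_left] at h2
    have := hP0 x
    by_contra! hcon
    have := mul_pos hc0 hcon
    linarith
  · have h0 : (c • A) x = 0 := by rw [smul_apply, hx, smul_zero]
    rw [hmem, h0, ← inner_self_eq_zero (𝕜 := ℝ), inner_comm_of_isSelfAdjoint hP]
    have : P (P x) = (c • A) ((c • A) x) := congrArg (fun F => F x) hPP
    rw [this, h0, map_zero, inner_zero_right]

end

section

/-! ### The spectral theorem for inverses of bounded positive operators -/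

variable {H : Type*} [NormedAddCommGroup H] [InnerProductSpace ℝ H]

/-- `K a` is the spectral subspace of `R⁻¹ - 1` belonging to `(-∞, a]`. -/
structure IsSpectralFamily (R : H →L[ℝ] H) (K : ℝ → Submodule ℝ H) : Prop where
  map_mem : ∀ a (C : H →L[ℝ] H), Commute C R → ∀ x ∈ K a, C x ∈ K a
  norm_le : ∀ a, ∀ x ∈ K a, ‖x‖ ^ 2 ≤ (1 + a) * inner ℝ (R x) x
  le_norm : ∀ a, ∀ x ∈ (K a)ᗮ, (1 + a) * inner ℝ (R x) x ≤ ‖x‖ ^ 2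
  mem_of_eq : ∀ a x, (1 + a) • R x = x → x ∈ K a

theorem IsSpectralFamily.map_self {R : H →L[ℝ] H} {K : ℝ → Submodule ℝ H}
    (h : IsSpectralFamily R K) (a : ℝ) : ∀ x ∈ K a, R x ∈ K a :=
  h.map_mem a R (Commute.refl R)

variable [CompleteSpace H]

/-- A bounded self-adjoint operator `0 ≤ R ≤ 1` with trivial kernel. -/
structure IsResolvent (R : H →L[ℝ] H) : Prop where
  selfAdjoint : IsSelfAdjoint R
  nonneg : ∀ x, 0 ≤ inner ℝ (R x) x
  le_one : ∀ x, inner ℝ (R x) x ≤ ‖x‖ ^ 2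
  injective : ∀ x, R x = 0 → x = 0

theorem exists_isSpectralFamily {R : H →L[ℝ] H} (hR : IsSelfAdjoint R) :
    ∃ K : ℝ → Submodule ℝ H, (∀ a, IsClosed (K a : Set H)) ∧ IsSpectralFamily R K := by
  have hA : ∀ a : ℝ, IsSelfAdjoint ((1 + a) • R - 1) := fun a => by
    refine IsSelfAdjoint.sub ?_ (IsSelfAdjoint.one _)
    rw [IsSelfAdjoint, star_smul, hR.star_eq, star_trivial]
  choose K hK hcomm hpos hneg hker using fun a => exists_nonneg_subspace (hA a)
  have hin : ∀ a x, inner ℝ (((1 + a) • R - 1) x) x = (1 + a) * inner ℝ (R x) x - ‖x‖ ^ 2 :=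
    fun a x => by
      change inner ℝ ((1 + a) • R x - x) x = _
      rw [inner_sub_left, real_inner_smul_left, real_inner_self_eq_norm_sq]
  refine ⟨K, hK, fun a C hC => hcomm a C ((hC.smul_right _).sub_right (Commute.one_right C)),
    fun a x hx => ?_, fun a x hx => ?_, fun a x hx => hker a x (sub_eq_zero.2 hx)⟩
  · have := hpos a x hx
    rw [hin] at this; linarith
  · have := hneg a x hx
    rw [hin] at this; linarith

theorem map_mem_orthogonal {R : H →L[ℝ] H} (hR : IsSelfAdjoint R) {M : Submodule ℝ H}
    (hM : ∀ x ∈ M, R x ∈ M) : ∀ x ∈ Mᗮ, R x ∈ Mᗮ := fun x hx y hy => by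
  rw [← inner_comm_of_isSelfAdjoint hR]
  exact hx _ (hM y hy)

theorem commute_starProjection {R : H →L[ℝ] H} (hR : IsSelfAdjoint R) {M : Submodule ℝ H}
    [M.HasOrthogonalProjection] (hM : ∀ x ∈ M, R x ∈ M) : Commute M.starProjection R := by
  ext x
  change M.starProjection (R x) = R (M.starProjection x)
  refine (Submodule.eq_starProjection_of_mem_orthogonal
    (hM _ (M.starProjection_apply_mem x)) ?_)
  rw [← map_sub]
  exact map_mem_orthogonal hR hM _ (M.sub_starProjection_mem_orthogonal x)

/-- A vector on which a nonpositive quadratic form vanishes lies in the kernel. -/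
theorem apply_eq_zero_of_inner_eq_zero {B : H →L[ℝ] H} (hB : IsSelfAdjoint B) {M : Submodule ℝ H}
    (hM : ∀ x ∈ M, B x ∈ M) (hneg : ∀ x ∈ M, inner ℝ (B x) x ≤ 0) {y : H} (hy : y ∈ M)
    (h0 : inner ℝ (B y) y = 0) : B y = 0 := by
  have key : ∀ t : ℝ, 2 * t * ‖B y‖ ^ 2 + t ^ 2 * inner ℝ (B (B y)) (B y) ≤ 0 := fun t => by
    have := hneg (y + t • B y) (M.add_mem hy (M.smul_mem t (hM y hy)))
    simp only [map_add, map_smul, inner_add_left, inner_add_right, real_inner_smul_left,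
      real_inner_smul_right, h0, real_inner_self_eq_norm_sq,
      inner_comm_of_isSelfAdjoint hB (B y) y] at this
    linarith
  set q := inner ℝ (B (B y)) (B y) with hq
  have hq0 : q ≤ 0 := hneg _ (hM y hy)
  have hs := sq_nonneg ‖B y‖
  have h1 : 0 < 1 - q := by linarith
  -- With this `t` the left side is a positive multiple of `‖B y‖⁴`; `1 - q` rather than `-q` keeps
  -- the denominator positive when `q = 0`.
  have := key (‖B y‖ ^ 2 / (1 - q))
  have h2 : 2 * (‖B y‖ ^ 2 / (1 - q)) * ‖B y‖ ^ 2 + (‖B y‖ ^ 2 / (1 - q)) ^ 2 * q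
      = (‖B y‖ ^ 2) ^ 2 * ((2 - q) / (1 - q) ^ 2) := by
    field_simp; ring
  rw [h2] at this
  have h3 : 0 < (2 - q) / (1 - q) ^ 2 := div_pos (by linarith) (by positivity)
  have h4 : (‖B y‖ ^ 2) ^ 2 = 0 := le_antisymm (nonpos_of_mul_nonpos_left this h3) (by positivity)
  simpa using h4

namespace IsSpectralFamily

variable {R : H →L[ℝ] H} {K : ℝ → Submodule ℝ H}

theorem eq_zero_of_neg (h : IsSpectralFamily R K) (hR : IsResolvent R) {a : ℝ} (ha : a < 0)
    {x : H} (hx : x ∈ K a) : x = 0 := by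
  have h1 := h.norm_le a x hx
  have h2 := hR.nonneg x
  have h3 := hR.le_one x
  have h4 : inner ℝ (R x) x = 0 := by nlinarith
  rw [h4, mul_zero] at h1
  simpa using le_antisymm h1 (sq_nonneg _)

/-- If `y` is orthogonal to every `K a`, then `(1 + a) ⟪R y, y⟫` stays bounded as `a → ∞`. So `⟪R y,
y⟫ = 0`, hence `R y = 0`, and injectivity of `R` gives `y = 0`. -/
theorem dense_iSup (h : IsSpectralFamily R K) (hR : IsResolvent R) :
    (⨆ a, K a).topologicalClosure = ⊤ := by
  rw [Submodule.topologicalClosure_eq_top_iff, Submodule.eq_bot_iff]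
  intro y hy
  have hle : ∀ a, (1 + a) * inner ℝ (R y) y ≤ ‖y‖ ^ 2 := fun a =>
    h.le_norm a y (Submodule.orthogonal_le (le_iSup K a) hy)
  have h0 : inner ℝ (R y) y = 0 := by
    refine le_antisymm ?_ (hR.nonneg y)
    by_contra! hpos
    have := hle (‖y‖ ^ 2 / inner ℝ (R y) y)
    rw [add_mul, div_mul_cancel₀ _ hpos.ne'] at this
    linarith
  refine hR.injective y (neg_eq_zero.1 ?_)
  refine apply_eq_zero_of_inner_eq_zero (B := -R) hR.selfAdjoint.neg (M := ⊤)
    (fun _ _ => Submodule.mem_top) (fun z _ => ?_) Submodule.mem_top ?_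
  · rw [neg_apply, inner_neg_left]; linarith [hR.nonneg z]
  · rw [neg_apply, inner_neg_left, h0, neg_zero]

variable [∀ a, (K a).HasOrthogonalProjection]

theorem starProjection_mem (h : IsSpectralFamily R K) (hR : IsResolvent R) (a b : ℝ) {x : H}
    (hx : x ∈ K a) : (K b).starProjection x ∈ K a :=
  h.map_mem a _ (commute_starProjection hR.selfAdjoint (h.map_self b)) x hx

/-- Projections onto `K b` preserve `K a`, so the part `y` of `x` orthogonal to `K b` is still in `K
a`. Then `(1 + b) ⟪R y, y⟫ ≤ ‖y‖² ≤ (1 + a) ⟪R y, y⟫` forces `y = 0`. -/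
theorem monotone (h : IsSpectralFamily R K) (hR : IsResolvent R) : Monotone K := by
  intro a b hab x hx
  rcases hab.eq_or_lt with rfl | hab
  · exact hx
  set y := x - (K b).starProjection x with hy
  have hya : y ∈ K a := (K a).sub_mem hx (h.starProjection_mem hR a b hx)
  have hyb : y ∈ (K b)ᗮ := (K b).sub_starProjection_mem_orthogonal x
  have h1 := h.norm_le a y hya
  have h2 := h.le_norm b y hyb
  have h3 := hR.nonneg y
  have h4 : inner ℝ (R y) y = 0 := by nlinarith
  rw [h4, mul_zero] at h1
  have h5 : y = 0 := by simpa using le_antisymm h1 (sq_nonneg _)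
  rw [← Submodule.starProjection_eq_self_iff]
  exact (sub_eq_zero.1 h5).symm

/-- The part `y` of `x` orthogonal to `K a` makes the form of `(1 + a) R - 1` vanish, while that
form is nonpositive on `(K a)ᗮ`. So `y` is in its kernel, which `mem_of_eq` places in `K a`:
assigning this eigenspace to `K a` is what yields right continuity. -/
theorem mem_of_forall_gt (h : IsSpectralFamily R K) (hR : IsResolvent R) {a : ℝ} {x : H}
    (hx : ∀ b, a < b → x ∈ K b) : x ∈ K a := by
  set y := x - (K a).starProjection x with hy
  have hyb : ∀ b, a < b → y ∈ K b := fun b hb =>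
    (K b).sub_mem (hx b hb) (h.starProjection_mem hR b a (hx b hb))
  have hya : y ∈ (K a)ᗮ := (K a).sub_starProjection_mem_orthogonal x
  have h1 : ‖y‖ ^ 2 ≤ (1 + a) * inner ℝ (R y) y := by
    have ht : Tendsto (fun b => (1 + b) * inner ℝ (R y) y) (𝓝[>] a)
        (𝓝 ((1 + a) * inner ℝ (R y) y)) := by
      refine Tendsto.mono_left ?_ nhdsWithin_le_nhds
      exact Continuous.tendsto (by fun_prop) a
    refine ge_of_tendsto ht ?_
    filter_upwards [self_mem_nhdsWithin] with b hb using h.norm_le b y (hyb b hb)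
  have hB : IsSelfAdjoint ((1 + a) • R - 1) := by
    refine IsSelfAdjoint.sub ?_ (IsSelfAdjoint.one _)
    rw [IsSelfAdjoint, star_smul, hR.selfAdjoint.star_eq, star_trivial]
  have hin : ∀ x, inner ℝ (((1 + a) • R - 1) x) x = (1 + a) * inner ℝ (R x) x - ‖x‖ ^ 2 :=
    fun x => by
      change inner ℝ ((1 + a) • R x - x) x = _
      rw [inner_sub_left, real_inner_smul_left, real_inner_self_eq_norm_sq]
  have h2 := h.le_norm a y hya
  have h3 : ((1 + a) • R - 1) y = 0 := by
    refine apply_eq_zero_of_inner_eq_zero hB (M := (K a)ᗮ) (fun z hz => ?_) (fun z hz => ?_) hya ?_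
    · exact (K a)ᗮ.sub_mem ((K a)ᗮ.smul_mem _
        (map_mem_orthogonal hR.selfAdjoint (h.map_self a) z hz)) hz
    · rw [hin]; linarith [h.le_norm a z hz]
    · rw [hin]; linarith
  have h4 : y ∈ K a := h.mem_of_eq a y (sub_eq_zero.1 h3)
  have h5 : y = 0 := by
    rw [← inner_self_eq_zero (𝕜 := ℝ)]
    exact hya y h4
  rw [← Submodule.starProjection_eq_self_iff]
  exact (sub_eq_zero.1 h5).symm

/-- The complements `(K b)ᗮ` increase as `b` decreases to `a`, so convergence of projections along
increasing subspaces applies to them over the order dual. -/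
theorem tendsto_nhdsGT (h : IsSpectralFamily R K) (hR : IsResolvent R) (a : ℝ) (x : H) :
    Tendsto (fun b => (K b).starProjection x) (𝓝[>] a) (𝓝 ((K a).starProjection x)) := by
  let U : (Set.Ioi a)ᵒᵈ → Submodule ℝ H := fun b => (K (OrderDual.ofDual b : Set.Ioi a))ᗮ
  have hU : Monotone U := fun b c hbc => Submodule.orthogonal_le (h.monotone hR hbc)
  have hcl : (⨆ b, U b).topologicalClosure = (K a)ᗮ := by
    have h1 : (⨆ b, U b)ᗮ = K a := by
      rw [← Submodule.iInf_orthogonal]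
      refine le_antisymm (fun y hy => h.mem_of_forall_gt hR fun b hb => ?_)
        (le_iInf fun b => ?_)
      · have := (Submodule.mem_iInf _).1 hy (OrderDual.toDual ⟨b, hb⟩)
        rwa [Submodule.orthogonal_orthogonal] at this
      · rw [Submodule.orthogonal_orthogonal]
        exact h.monotone hR (OrderDual.ofDual b).2.le
    rw [← h1, Submodule.orthogonal_orthogonal_eq_closure]
  have ht := Submodule.starProjection_tendsto_closure_iSup U hU x
  simp only [hcl] at ht
  have ht2 : Tendsto (fun b : Set.Ioi a => (K b)ᗮ.starProjection x) atBot
      (𝓝 ((K a)ᗮ.starProjection x)) := ht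
  have hsub : ∀ b, (K b)ᗮ.starProjection x = x - (K b).starProjection x := fun b => by
    rw [Submodule.starProjection_orthogonal']; rfl
  simp only [hsub] at ht2
  have ht3 := (tendsto_const_nhds (x := x)).sub ht2
  simp only [sub_sub_cancel] at ht3
  rw [← map_coe_Ioi_atBot a]
  exact tendsto_map'_iff.2 ht3

/-- The resolution of the identity of `R⁻¹ - 1`. -/
def resolution (h : IsSpectralFamily R K) (hR : IsResolvent R) : ResolutionOfIdentity H where
  proj a := (K a).starProjection
  symm a x y := Submodule.inner_starProjection_left_eq_right _ x y
  proj_proj a b x := by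
    rcases le_total a b with hab | hab
    · rw [min_eq_left hab]
      exact congrArg (fun F => F x)
        (Submodule.starProjection_comp_starProjection_of_le (h.monotone hR hab))
    · rw [min_eq_right hab, Submodule.starProjection_eq_self_iff]
      exact h.monotone hR hab (Submodule.starProjection_apply_mem _ _)
  right_continuous := h.tendsto_nhdsGT hR
  tendsto_atBot x := by
    refine tendsto_const_nhds.congr' ?_
    filter_upwards [eventually_lt_atBot 0] with a ha
    exact (h.eq_zero_of_neg hR ha (Submodule.starProjection_apply_mem _ _)).symm
  tendsto_atTop x := Submodule.starProjection_tendsto_self K (h.monotone hR) x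
    (h.dense_iSup hR).ge

theorem nonneg_resolution (h : IsSpectralFamily R K) (hR : IsResolvent R) :
    (h.resolution hR).Nonneg := fun _ ha _ =>
  h.eq_zero_of_neg hR ha (Submodule.starProjection_apply_mem _ _)

end IsSpectralFamily

/-- A function whose increments are dominated by `(c - b) (m c - m b)` is constant. -/
theorem eq_of_abs_sub_le_mul {f m : ℝ → ℝ}
    (h : ∀ b c, b ≤ c → |f c - f b| ≤ (c - b) * (m c - m b)) {b c : ℝ} (hbc : b ≤ c) :
    f b = f c := by
  -- Cut `[b, c]` into `n + 1` equal pieces; the increments of `m` telescope.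
  have key : ∀ n : ℕ, |f c - f b| ≤ (c - b) * (m c - m b) * (1 / ((n : ℝ) + 1)) := fun n => by
    set δ : ℝ := (c - b) / ((n : ℝ) + 1) with hδ
    have hδ0 : 0 ≤ δ := div_nonneg (sub_nonneg.2 hbc) (by positivity)
    let p : ℕ → ℝ := fun i => b + i * δ
    have hp0 : p 0 = b := by simp [p]
    have hpn : p (n + 1) = c := by
      simp only [p, hδ]; push_cast; field_simp; ring
    have hp : ∀ i, p (i + 1) - p i = δ := fun i => by simp only [p]; push_cast; ring
    calc |f c - f b| = |∑ i ∈ Finset.range (n + 1), (f (p (i + 1)) - f (p i))| := by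
          rw [Finset.sum_range_sub (fun i => f (p i)), hpn, hp0]
      _ ≤ ∑ i ∈ Finset.range (n + 1), |f (p (i + 1)) - f (p i)| := Finset.abs_sum_le_sum_abs _ _
      _ ≤ ∑ i ∈ Finset.range (n + 1), δ * (m (p (i + 1)) - m (p i)) := by
          refine Finset.sum_le_sum fun i _ => ?_
          have := h (p i) (p (i + 1)) (by linarith [hp i])
          rwa [hp] at this
      _ = _ := by
          rw [← Finset.mul_sum, Finset.sum_range_sub (fun i => m (p i)), hpn, hp0, hδ]
          ring
  have ht := (tendsto_one_div_add_atTop_nhds_zero_nat (𝕜 := ℝ)).const_mul ((c - b) * (m c - m b))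
  rw [mul_zero] at ht
  have := ge_of_tendsto' ht key
  have h0 := abs_nonpos_iff.1 this
  linarith

/-! ### Identification of the resolvent -/

open ResolutionOfIdentity

theorem resolventFun_antitone : Antitone resolventFun := fun b c hbc => by
  unfold resolventFun
  exact inv_anti₀ (by positivity) (by gcongr)

theorem resolventFun_sub_le {b c : ℝ} (hbc : b ≤ c) : resolventFun b - resolventFun c ≤ c - b := by
  have h1 : 0 ≤ max b 0 := le_max_right _ _
  have h2 : max b 0 ≤ max c 0 := max_le_max_right 0 hbc
  have h3 : max c 0 - max b 0 ≤ c - b := by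
    rcases le_total b 0 with hb | hb <;> rcases le_total c 0 with hc | hc <;>
      simp only [hb, hc, max_eq_left, max_eq_right] <;> linarith
  have h4 : resolventFun b - resolventFun c
      = (max c 0 - max b 0) / ((1 + max b 0) * (1 + max c 0)) := by
    unfold resolventFun
    have : 1 + max b 0 ≠ 0 := by positivity
    have : 1 + max c 0 ≠ 0 := by positivity
    field_simp; ring
  rw [h4]
  refine (div_le_self (by linarith) ?_).trans h3
  nlinarith

namespace IsSpectralFamily

variable {R : H →L[ℝ] H} {K : ℝ → Submodule ℝ H} [∀ a, (K a).HasOrthogonalProjection]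

/-- Let `y` be the component of `x` in the window `(b, c]`. The forms of `R` and of `∫ (1 + λ)⁻¹
dE_λ` at `y` both lie between `‖y‖²` times the values of `resolventFun` at `c` and at `b`, and these
values differ by at most `c - b`. -/
theorem abs_sub_le (h : IsSpectralFamily R K) (hR : IsResolvent R) (x : H) {b c : ℝ}
    (hbc : b ≤ c) :
    |(inner ℝ (R ((K c).starProjection x)) ((K c).starProjection x)
        - inner ℝ ((h.resolution hR).fc resolventFun x) ((K c).starProjection x))
      - (inner ℝ (R ((K b).starProjection x)) ((K b).starProjection x)
        - inner ℝ ((h.resolution hR).fc resolventFun x) ((K b).starProjection x))|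
      ≤ (c - b) * (inner ℝ ((K c).starProjection x) x - inner ℝ ((K b).starProjection x) x) := by
  set E := h.resolution hR with hE
  set y := (K c).starProjection x - (K b).starProjection x with hy
  have hb := Submodule.starProjection_apply_mem (K b) x
  have hyc : y ∈ K c :=
    (K c).sub_mem (Submodule.starProjection_apply_mem _ _) (h.monotone hR hbc hb)
  have hyb : y ∈ (K b)ᗮ := by
    have h1 := (K b).sub_starProjection_mem_orthogonal x
    have h2 := Submodule.orthogonal_le (h.monotone hR hbc)
      ((K c).sub_starProjection_mem_orthogonal x)
    have : y = (x - (K b).starProjection x) - (x - (K c).starProjection x) := by rw [hy]; abel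
    rw [this]
    exact (K b)ᗮ.sub_mem h1 h2
  have hym : (E.spectralMeasure x).real (Set.Ioc b c) = ‖y‖ ^ 2 := by
    have hsplit : (K c).starProjection x = (K b).starProjection x + y := by rw [hy]; abel
    have h0 : inner ℝ ((K b).starProjection x) y = 0 := hyb _ hb
    rw [spectralMeasure_real_Ioc x hbc, ← norm_proj_sq, ← norm_proj_sq]
    change ‖(K c).starProjection x‖ ^ 2 - ‖(K b).starProjection x‖ ^ 2 = _
    rw [hsplit, norm_add_sq_real, h0]; ring
  have hR1 : inner ℝ (R ((K c).starProjection x)) ((K c).starProjection x)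
      - inner ℝ (R ((K b).starProjection x)) ((K b).starProjection x) = inner ℝ (R y) y := by
    have hsplit : (K c).starProjection x = (K b).starProjection x + y := by rw [hy]; abel
    have h0 : inner ℝ (R ((K b).starProjection x)) y = 0 := hyb _ (h.map_self b _ hb)
    have h0' : inner ℝ (R y) ((K b).starProjection x) = 0 := by
      rw [inner_comm_of_isSelfAdjoint hR.selfAdjoint, real_inner_comm, h0]
    rw [hsplit, map_add, inner_add_left, inner_add_right, inner_add_right, h0, h0']; ring
  have hI : inner ℝ (E.fc resolventFun x) ((K c).starProjection x)
      - inner ℝ (E.fc resolventFun x) ((K b).starProjection x)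
      = ∫ a, (Set.Ioc b c).indicator resolventFun a ∂(E.spectralMeasure x) := by
    have h1 := fun a => E.inner_fc_proj bddMeas_resolventFun a x x
    simp only [polar_self] at h1
    change inner ℝ (E.fc resolventFun x) (E.proj c x)
      - inner ℝ (E.fc resolventFun x) (E.proj b x) = _
    have hint := fun a : ℝ => (bddMeas_resolventFun.indicator
      (measurableSet_Iic (a := a))).integrable (E.spectralMeasure x)
    rw [h1, h1, ← integral_sub (hint _) (hint _), ← Set.Iic_sdiff_Iic,
      Set.indicator_sdiff (Set.Iic_subset_Iic.2 hbc)]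
    rfl
  have hint := (bddMeas_resolventFun.indicator
    (measurableSet_Ioc (a := b) (b := c))).integrable (E.spectralMeasure x)
  have hconst := fun r : ℝ => ((BddMeas.const r).indicator
    (measurableSet_Ioc (a := b) (b := c))).integrable (E.spectralMeasure x)
  have hval : ∀ r : ℝ, ∫ a, (Set.Ioc b c).indicator (fun _ => r) a ∂(E.spectralMeasure x)
      = ‖y‖ ^ 2 * r := fun r => by
    rw [integral_indicator_const _ measurableSet_Ioc, hym, smul_eq_mul]
  have hup : ∫ a, (Set.Ioc b c).indicator resolventFun a ∂(E.spectralMeasure x)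
      ≤ ‖y‖ ^ 2 * resolventFun b := by
    rw [← hval]
    refine integral_mono hint (hconst _) fun a => ?_
    by_cases ha : a ∈ Set.Ioc b c
    · simpa [ha] using resolventFun_antitone ha.1.le
    · simp [ha]
  have hlow : ‖y‖ ^ 2 * resolventFun c
      ≤ ∫ a, (Set.Ioc b c).indicator resolventFun a ∂(E.spectralMeasure x) := by
    rw [← hval]
    refine integral_mono (hconst _) hint fun a => ?_
    by_cases ha : a ∈ Set.Ioc b c
    · simpa [ha] using resolventFun_antitone ha.2
    · simp [ha]
  have hup' : inner ℝ (R y) y ≤ ‖y‖ ^ 2 * resolventFun b := by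
    rcases le_total 0 b with hb0 | hb0
    · rw [resolventFun, max_eq_left hb0, ← div_eq_mul_inv, le_div_iff₀ (by linarith), mul_comm]
      exact h.le_norm b y hyb
    · rw [resolventFun, max_eq_right hb0, add_zero, inv_one, mul_one]
      exact hR.le_one y
  have hlow' : ‖y‖ ^ 2 * resolventFun c ≤ inner ℝ (R y) y := by
    rcases le_or_gt 0 c with hc0 | hc0
    · rw [resolventFun, max_eq_left hc0, ← div_eq_mul_inv, div_le_iff₀ (by linarith), mul_comm]
      exact h.norm_le c y hyc
    · rw [h.eq_zero_of_neg hR hc0 hyc]; simp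
  have hm : inner ℝ ((K c).starProjection x) x - inner ℝ ((K b).starProjection x) x = ‖y‖ ^ 2 :=
    (spectralMeasure_real_Ioc (E := E) x hbc).symm.trans hym
  rw [hm, sub_sub_sub_comm, hR1, hI, abs_le]
  have hl := mul_le_mul_of_nonneg_left (resolventFun_sub_le hbc) (sq_nonneg ‖y‖)
  constructor <;> nlinarith

/-- By `abs_sub_le` the difference of the two forms, truncated at level `c`, does not depend on `c`.
It vanishes at `c = -1`, where `K c = 0`, so its limit as `c → ∞` is zero; a symmetric operator with
zero quadratic form is zero. -/
theorem fc_resolventFun (h : IsSpectralFamily R K) (hR : IsResolvent R) :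
    (h.resolution hR).fc resolventFun = R := by
  set E := h.resolution hR with hE
  have hself : ∀ x, inner ℝ (E.fc resolventFun x) x = inner ℝ (R x) x := fun x => by
    have hproj : Tendsto (fun c => (K c).starProjection x) atTop (𝓝 x) := E.tendsto_atTop x
    have ht1 : Tendsto (fun c => inner ℝ (R ((K c).starProjection x)) ((K c).starProjection x)
        - inner ℝ (E.fc resolventFun x) ((K c).starProjection x)) atTop
        (𝓝 (inner ℝ (R x) x - inner ℝ (E.fc resolventFun x) x)) :=
      (((R.continuous.tendsto x).comp hproj).inner hproj).sub (tendsto_const_nhds.inner hproj)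
    have ht2 : Tendsto (fun c => inner ℝ (R ((K c).starProjection x)) ((K c).starProjection x)
        - inner ℝ (E.fc resolventFun x) ((K c).starProjection x)) atTop (𝓝 0) := by
      refine tendsto_const_nhds.congr' ?_
      filter_upwards [eventually_ge_atTop (-1)] with c hc
      have := eq_of_abs_sub_le_mul (fun b c hbc => h.abs_sub_le hR x hbc) hc
      have h0 : (K (-1)).starProjection x = 0 :=
        h.eq_zero_of_neg hR (by norm_num) (Submodule.starProjection_apply_mem _ _)
      rw [← this, h0]; simp
    have := tendsto_nhds_unique ht1 ht2
    linarith
  have hsymm : (E.fc resolventFun - R : H →L[ℝ] H).toLinearMap.IsSymmetric := fun x y => by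
    change inner ℝ (E.fc resolventFun x - R x) y = inner ℝ x (E.fc resolventFun y - R y)
    rw [inner_sub_left, inner_sub_right, E.fc_symm bddMeas_resolventFun,
      inner_comm_of_isSelfAdjoint hR.selfAdjoint]
  have h0 := hsymm.inner_map_self_eq_zero.1 fun x => by
    change inner ℝ (E.fc resolventFun x - R x) x = 0
    rw [inner_sub_left, hself, sub_self]
  ext x
  exact sub_eq_zero.1 (congrArg (fun F => F x) h0)

end IsSpectralFamily

/-- **Spectral theorem**: if `R = (1 + T)⁻¹` is a bounded self-adjoint operator with
`0 ≤ R ≤ 1`, then `T` has a spectral resolution. -/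
theorem exists_isSpectralResolution {T : H →ₗ.[ℝ] H} {R : H →L[ℝ] H} (hR : IsResolvent R)
    (hT : ∀ x y, (x, y) ∈ T.graph ↔ x = R (x + y)) :
    ∃ E : ResolutionOfIdentity H, E.IsSpectralResolution T := by
  obtain ⟨K, hK, h⟩ := exists_isSpectralFamily hR.selfAdjoint
  have : ∀ a, (K a).HasOrthogonalProjection := fun a => by
    have := (hK a).completeSpace_coe
    infer_instance
  refine ⟨h.resolution hR, fun x y => ?_⟩
  rw [hT, (h.nonneg_resolution hR).hasIntegral_id_iff, h.fc_resolventFun hR]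

end

section

/-! ### Von Neumann's theorem on `D* D` -/

section Graphs

variable {E F G : Type*} [AddCommGroup E] [Module ℝ E] [AddCommGroup F] [Module ℝ F]
  [AddCommGroup G] [Module ℝ G]

theorem mem_graph_pcomp (g : F →ₗ.[ℝ] G) (f : E →ₗ.[ℝ] F) (x : E) (y : G) :
    (x, y) ∈ (pcomp g f).graph ↔ ∃ w, (x, w) ∈ f.graph ∧ (w, y) ∈ g.graph := by
  have key : ∀ (z : (pcomp g f).domain) (hz : (z : E) ∈ f.domain) (hw : f ⟨z, hz⟩ ∈ g.domain),
      pcomp g f z = g ⟨f ⟨z, hz⟩, hw⟩ := fun z hz hw => by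
    refine congrArg g.toFun (Subtype.ext ?_)
    exact LinearPMap.domRestrict_apply (f := f) (x := z) (y := ⟨z, hz⟩) rfl
  constructor
  · intro h
    obtain ⟨z, hz, hy⟩ := (LinearPMap.mem_graph_iff _).1 h
    simp only at hz hy
    obtain ⟨w, hw, hwz⟩ := Submodule.mem_map.1 z.2.1
    have hzd : (z : E) ∈ f.domain := hwz ▸ w.2
    have hfw : f ⟨z, hzd⟩ ∈ g.domain := by
      have : (⟨z, hzd⟩ : f.domain) = w := Subtype.ext hwz.symm
      rw [this]; exact hw
    refine ⟨f ⟨z, hzd⟩, (LinearPMap.mem_graph_iff _).2 ⟨⟨z, hzd⟩, hz, rfl⟩,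
      (LinearPMap.mem_graph_iff _).2 ⟨⟨_, hfw⟩, rfl, ?_⟩⟩
    rw [← key z hzd hfw, hy]
  · rintro ⟨w, hw, hy⟩
    obtain ⟨u, hu, huw⟩ := (LinearPMap.mem_graph_iff _).1 hw
    obtain ⟨v, hv, hvy⟩ := (LinearPMap.mem_graph_iff _).1 hy
    simp only at hu huw hv hvy
    have hfu : f u ∈ g.domain := by rw [huw, ← hv]; exact v.2
    have hmem : (u : E) ∈ (pcomp g f).domain :=
      ⟨Submodule.mem_map.2 ⟨u, hfu, rfl⟩, u.2⟩
    refine (LinearPMap.mem_graph_iff _).2 ⟨⟨u, hmem⟩, hu, ?_⟩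
    rw [key ⟨u, hmem⟩ u.2 hfu, ← hvy]
    exact congrArg g.toFun (Subtype.ext (huw.trans hv.symm))

end Graphs

variable {H F : Type*} [NormedAddCommGroup H] [InnerProductSpace ℝ H]
  [NormedAddCommGroup F] [InnerProductSpace ℝ F]

/-- The closure of `G` in the Hilbert space sum of `H` and `F`. -/
def hilbertGraph (G : Submodule ℝ (H × F)) : Submodule ℝ (WithLp 2 (H × F)) :=
  G.topologicalClosure.comap (WithLp.prodContinuousLinearEquiv 2 ℝ H F).toLinearEquiv.toLinearMap

/-- The inclusion of the first summand. -/
def inlL2 : H →L[ℝ] WithLp 2 (H × F) :=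
  (WithLp.prodContinuousLinearEquiv 2 ℝ H F).symm.toContinuousLinearMap ∘L
    ContinuousLinearMap.inl ℝ H F

theorem inner_inlL2 (x : H) (p : WithLp 2 (H × F)) :
    inner ℝ (inlL2 x) p = inner ℝ x p.ofLp.1 := by
  rw [WithLp.prod_inner_apply]
  change inner ℝ x _ + inner ℝ (0 : F) _ = _
  rw [inner_zero_left, add_zero]

theorem norm_inlL2 (x : H) : ‖(inlL2 x : WithLp 2 (H × F))‖ = ‖x‖ := by
  have h := inner_inlL2 x (inlL2 x : WithLp 2 (H × F))
  rw [real_inner_self_eq_norm_sq] at h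
  have h2 : inner ℝ x (inlL2 x : WithLp 2 (H × F)).ofLp.1 = ‖x‖ ^ 2 := real_inner_self_eq_norm_sq x
  rw [h2] at h
  exact (pow_left_inj₀ (norm_nonneg _) (norm_nonneg _) two_ne_zero).1 h

variable [CompleteSpace H]

theorem mem_graph_adjoint {D : H →ₗ.[ℝ] F} (hD : Dense (D.domain : Set H)) (w : F) (y : H) :
    (w, y) ∈ D.adjoint.graph ↔ ∀ v u, (v, u) ∈ D.graph → inner ℝ y v = inner ℝ w u := by
  constructor
  · intro h v u hvu
    obtain ⟨z, rfl, rfl⟩ := (LinearPMap.mem_graph_iff _).1 h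
    obtain ⟨v', rfl, rfl⟩ := (LinearPMap.mem_graph_iff _).1 hvu
    exact LinearPMap.adjoint_isFormalAdjoint hD z v'
  · intro h
    have h' : ∀ v : D.domain, inner ℝ y (v : H) = inner ℝ w (D v) :=
      fun v => h _ _ (D.mem_graph v)
    exact (LinearPMap.mem_graph_iff _).2
      ⟨⟨w, LinearPMap.mem_adjoint_domain_of_exists w ⟨y, h'⟩⟩, rfl,
        LinearPMap.adjoint_apply_eq hD _ h'⟩

/-- The adjoint relation passes to the closed graph by continuity, so `D* D` is described by the
closed graph alone. -/
theorem mem_graph_adjoint_comp_closure {D : H →ₗ.[ℝ] F} (hD : Dense (D.domain : Set H))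
    (hc : D.IsClosable) (x y : H) :
    (x, y) ∈ (pcomp D.adjoint D.closure).graph ↔
      ∃ w, (x, w) ∈ D.graph.topologicalClosure ∧
        ∀ p ∈ D.graph.topologicalClosure, inner ℝ y p.1 = inner ℝ w p.2 := by
  rw [mem_graph_pcomp, hc.graph_closure_eq_closure_graph]
  refine exists_congr fun w => and_congr_right fun _ => ?_
  rw [mem_graph_adjoint hD]
  constructor
  · intro h p hp
    have hcl : IsClosed {p : H × F | inner ℝ y p.1 = inner ℝ w p.2} :=
      isClosed_eq (by fun_prop) (by fun_prop)
    rw [← hc.graph_closure_eq_closure_graph] at hp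
    exact closure_minimal (fun q hq => h q.1 q.2 hq) hcl hp
  · intro h v u hvu
    refine h (v, u) ?_
    rw [← hc.graph_closure_eq_closure_graph]
    exact D.graph.le_topologicalClosure hvu

theorem inner_adjoint_comp_closure_nonneg {D : H →ₗ.[ℝ] F}
    (hD : Dense (D.domain : Set H)) (hc : D.IsClosable) (x y : H)
    (h : (x, y) ∈ (pcomp D.adjoint D.closure).graph) : 0 ≤ inner ℝ y x := by
  obtain ⟨w, hw, h⟩ := (mem_graph_adjoint_comp_closure hD hc x y).1 h
  have : inner ℝ y x = inner ℝ w w := h (x, w) hw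
  rw [this]
  exact real_inner_self_nonneg

variable [CompleteSpace F]

section Resolvent

variable (G : Submodule ℝ (H × F))

instance : (hilbertGraph G).HasOrthogonalProjection := by
  have : IsClosed (hilbertGraph G : Set (WithLp 2 (H × F))) :=
    G.isClosed_topologicalClosure.preimage (WithLp.prodContinuousLinearEquiv 2 ℝ H F).continuous
  have := this.completeSpace_coe
  infer_instance

/-- The operator `(1 + D* D)⁻¹`, where `G` is the graph of `D`. -/
def graphResolvent : H →L[ℝ] H :=
  ContinuousLinearMap.fst ℝ H F ∘L
    (WithLp.prodContinuousLinearEquiv 2 ℝ H F).toContinuousLinearMap ∘L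
    (hilbertGraph G).starProjection ∘L inlL2

theorem inner_graphResolvent (x z : H) :
    inner ℝ (graphResolvent G x) z
      = inner ℝ ((hilbertGraph G).starProjection (inlL2 x)) (inlL2 z) := by
  rw [real_inner_comm, real_inner_comm (inlL2 z), inner_inlL2]
  rfl

theorem inner_graphResolvent_self (x : H) :
    inner ℝ (graphResolvent G x) x = ‖(hilbertGraph G).starProjection (inlL2 x)‖ ^ 2 := by
  rw [inner_graphResolvent, ← real_inner_self_eq_norm_sq,
    Submodule.inner_starProjection_left_eq_right, Submodule.inner_starProjection_left_eq_right,
    Submodule.starProjection_eq_self_iff.2 (Submodule.starProjection_apply_mem _ _)]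

/-- `R x = (1 + D* D)⁻¹ x` solves `⟪R x, v⟫ + ⟪D R x, D v⟫ = ⟪x, v⟫`. -/
theorem exists_graphResolvent (x : H) :
    ∃ w, (graphResolvent G x, w) ∈ G.topologicalClosure ∧
      ∀ p ∈ G.topologicalClosure, inner ℝ (x - graphResolvent G x) p.1 = inner ℝ w p.2 := by
  set q := (hilbertGraph G).starProjection (inlL2 x) with hq
  refine ⟨q.ofLp.2, (hilbertGraph G).starProjection_apply_mem (inlL2 x), fun p hp => ?_⟩
  have h := Submodule.inner_left_of_mem_orthogonal (K := hilbertGraph G)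
    (u := WithLp.toLp 2 p) hp ((hilbertGraph G).sub_starProjection_mem_orthogonal (inlL2 x))
  rw [inner_sub_left, inner_inlL2, WithLp.prod_inner_apply, ← hq] at h
  have h2 : graphResolvent G x = q.ofLp.1 := rfl
  rw [inner_sub_left, h2]
  simp only at h
  linarith

/-- Weak solutions are unique: the difference of two lies in the closed graph, and testing with it
gives `‖w - w'‖² = -‖x - r‖²`. -/
theorem eq_graphResolvent_iff (x y : H) :
    x = graphResolvent G (x + y) ↔ ∃ w, (x, w) ∈ G.topologicalClosure ∧
      ∀ p ∈ G.topologicalClosure, inner ℝ y p.1 = inner ℝ w p.2 := by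
  obtain ⟨w', hw', h'⟩ := exists_graphResolvent G (x + y)
  constructor
  · intro h
    rw [← h, add_sub_cancel_left] at h'
    rw [← h] at hw'
    exact ⟨w', hw', h'⟩
  · rintro ⟨w, hw, h⟩
    have hd := G.topologicalClosure.sub_mem hw hw'
    have h1 := h _ hd
    have h2 := h' _ hd
    simp only [Prod.fst_sub, Prod.snd_sub] at h1 h2
    set r := graphResolvent G (x + y)
    have h3 : inner ℝ (w - w') (w - w') = -inner ℝ (x - r) (x - r) := by
      have e : y = (x + y - r) - (x - r) := by abel
      rw [e, inner_sub_left, h2] at h1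
      rw [inner_sub_left w]; linarith
    rw [real_inner_self_eq_norm_sq, real_inner_self_eq_norm_sq] at h3
    have h4 : ‖x - r‖ ^ 2 = 0 := by
      have := sq_nonneg ‖w - w'‖
      have := sq_nonneg ‖x - r‖
      linarith
    exact sub_eq_zero.1 (by simpa using h4)

/-- The operator is the compression to `H` of an orthogonal projection, hence self-adjoint between
`0` and `1`. If it kills `x`, then `(x, 0)` is orthogonal to the graph, so `x` is orthogonal to a
dense domain. -/
theorem isResolvent_graphResolvent (hG : Dense (G.map (LinearMap.fst ℝ H F) : Set H)) :
    IsResolvent (graphResolvent G) where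
  selfAdjoint := by
    rw [ContinuousLinearMap.isSelfAdjoint_iff_isSymmetric]
    intro x z
    change inner ℝ (graphResolvent G x) z = inner ℝ x (graphResolvent G z)
    rw [inner_graphResolvent, Submodule.inner_starProjection_left_eq_right, real_inner_comm,
      ← inner_graphResolvent, real_inner_comm]
  nonneg x := by rw [inner_graphResolvent_self]; positivity
  le_one x := by
    rw [inner_graphResolvent_self, ← norm_inlL2 (F := F) x]
    exact pow_le_pow_left₀ (norm_nonneg _) (Submodule.norm_starProjection_apply_le _ _) 2
  injective x hx := by
    have h0 := inner_graphResolvent_self G x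
    rw [hx, inner_zero_left] at h0
    have h1 : (hilbertGraph G).starProjection (inlL2 x) = 0 := by simpa using h0.symm
    have horth := (hilbertGraph G).sub_starProjection_mem_orthogonal (inlL2 x)
    rw [h1, sub_zero] at horth
    refine hG.eq_zero_of_inner_left (𝕜 := ℝ) fun v hv => ?_
    obtain ⟨p, hp, hpv⟩ := Submodule.mem_map.1 hv
    have h2 := Submodule.inner_left_of_mem_orthogonal (K := hilbertGraph G)
      (u := WithLp.toLp 2 p) (G.le_topologicalClosure hp) horth
    rw [inner_inlL2] at h2
    rw [← hpv]; exact h2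

end Resolvent

theorem exists_isSpectralResolution_adjoint_comp_closure {D : H →ₗ.[ℝ] F}
    (hD : Dense (D.domain : Set H)) (hc : D.IsClosable) :
    ∃ E : ResolutionOfIdentity H, E.IsSpectralResolution (pcomp D.adjoint D.closure) := by
  refine exists_isSpectralResolution (R := graphResolvent D.graph)
    (isResolvent_graphResolvent _ ?_) fun x y => ?_
  · rwa [LinearPMap.graph_map_fst_eq_domain]
  · rw [mem_graph_adjoint_comp_closure hD hc, eq_graphResolvent_iff]

end

section

/-! ### The covariant derivative is densely defined and closable -/

theorem integrable_inner_of_memLp {α V : Type*} [MeasurableSpace α] {μ : Measure α}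
    [NormedAddCommGroup V] [InnerProductSpace ℝ V] {f g : α → V} (hf : MemLp f 2 μ)
    (hg : MemLp g 2 μ) : Integrable (fun x => inner ℝ (f x) (g x)) μ := by
  refine (L2.integrable_inner (𝕜 := ℝ) (hf.toLp f) (hg.toLp g)).congr ?_
  filter_upwards [hf.coeFn_toLp, hg.coeFn_toLp] with x h1 h2
  rw [h1, h2]

theorem L2_inner_eq_integral {α V : Type*} [MeasurableSpace α] {μ : Measure α}
    [NormedAddCommGroup V] [InnerProductSpace ℝ V] (p q : Lp V 2 μ) {f g : α → V}
    (hf : p =ᵐ[μ] f) (hg : q =ᵐ[μ] g) : inner ℝ p q = ∫ x, inner ℝ (f x) (g x) ∂μ := by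
  rw [L2.inner_def]
  refine integral_congr_ae ?_
  filter_upwards [hf, hg] with x h1 h2
  rw [h1, h2]

section Bracket

variable {𝔤 : Type*} [NormedLieRing 𝔤] [InvariantLieAlgebra 𝔤]

theorem inner_lie_comm (X Y Z : 𝔤) : inner ℝ ⁅X, Y⁆ Z = -inner ℝ Y ⁅X, Z⁆ := by
  rw [← lie_skew, inner_neg_left, InvariantLieAlgebra.inner_lie]

variable [FiniteDimensional ℝ 𝔤]

/-- The Lie bracket as a bounded bilinear map. -/
def bracket (𝔤 : Type*) [NormedLieRing 𝔤] [InvariantLieAlgebra 𝔤] [FiniteDimensional ℝ 𝔤] :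
    𝔤 →L[ℝ] 𝔤 →L[ℝ] 𝔤 :=
  LinearMap.toContinuousLinearMap
    (LinearMap.toContinuousLinearMap.toLinearMap ∘ₗ
      LinearMap.mk₂ ℝ (fun X Y : 𝔤 => ⁅X, Y⁆) add_lie smul_lie lie_add
        (fun c X Y => lie_smul c X Y))

end Bracket

variable {n : ℕ} {𝔤 : Type*} [NormedLieRing 𝔤] [InvariantLieAlgebra 𝔤]

theorem IsTestSection.continuous_fderiv {φ : Space n → 𝔤} (hφ : IsTestSection φ) (v : Space n) :
    Continuous fun x => fderiv ℝ φ x v :=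
  (hφ.contDiff.continuous_fderiv (by simp)).clm_apply continuous_const

theorem IsTestSection.memLp {φ : Space n → 𝔤} (hφ : IsTestSection φ) : MemLp φ 2 volume :=
  hφ.contDiff.continuous.memLp_of_hasCompactSupport hφ.hasCompactSupport

theorem IsTestSection.memLp_fderiv {φ : Space n → 𝔤} (hφ : IsTestSection φ) (v : Space n) :
    MemLp (fun x => fderiv ℝ φ x v) 2 volume :=
  (hφ.continuous_fderiv v).memLp_of_hasCompactSupport (hφ.hasCompactSupport.fderiv_apply ℝ v)

theorem covGrad_graph (A : Connection n 𝔤) : (covGrad A).graph = covGradGraph A :=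
  Submodule.toLinearPMap_graph_eq _ fun p hp h0 => covGradGraph_single A p hp h0

variable [FiniteDimensional ℝ 𝔤] (A : Connection n 𝔤) (i : Fin n)

/-- On the compact support of `φ` the connection is square-integrable, and `φ` and the bracket are
bounded. -/
theorem IsTestSection.memLp_lie {φ : Space n → 𝔤} (hφ : IsTestSection φ) :
    MemLp (fun x => ⁅A.toFun i x, φ x⁆) 2 volume := by
  obtain ⟨C, hC⟩ := hφ.contDiff.continuous.bounded_above_of_compact_support hφ.hasCompactSupport
  have hA := A.locallyL2 i _ hφ.hasCompactSupport
  have hmeas : MeasurableSet (tsupport φ) := (isClosed_tsupport φ).measurableSet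
  have hind : (fun x => ⁅A.toFun i x, φ x⁆)
      = (tsupport φ).indicator fun x => ⁅A.toFun i x, φ x⁆ := by
    ext x
    by_cases hx : x ∈ tsupport φ
    · rw [Set.indicator_of_mem hx]
    · rw [Set.indicator_of_notMem hx, image_eq_zero_of_notMem_tsupport hx, lie_zero]
  rw [hind, memLp_indicator_iff_restrict hmeas]
  refine hA.of_le_mul (c := ‖bracket 𝔤‖ * C) ?_ (Eventually.of_forall fun x => ?_)
  · exact (bracket 𝔤).aestronglyMeasurable_comp₂ hA.1
      hφ.contDiff.continuous.aestronglyMeasurable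
  · calc ‖⁅A.toFun i x, φ x⁆‖ ≤ ‖bracket 𝔤‖ * ‖A.toFun i x‖ * ‖φ x‖ :=
          (bracket 𝔤).le_opNorm₂ _ _
      _ ≤ ‖bracket 𝔤‖ * ‖A.toFun i x‖ * C := by gcongr; exact hC x
      _ = _ := by ring

theorem IsTestSection.memLp_covDeriv {φ : Space n → 𝔤} (hφ : IsTestSection φ) :
    MemLp (covDeriv A i φ) 2 volume :=
  (hφ.memLp_fderiv _).add (hφ.memLp_lie A i)

/-- The formal adjoint of `∇̂ᵢ` is `-∇̂ᵢ`. -/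
theorem integral_inner_covDeriv {φ ψ : Space n → 𝔤} (hφ : IsTestSection φ)
    (hψ : IsTestSection ψ) :
    ∫ x, inner ℝ (covDeriv A i φ x) (ψ x) = -∫ x, inner ℝ (φ x) (covDeriv A i ψ x) := by
  set v : Space n := EuclideanSpace.single i 1 with hv
  have hd := fun (χ : Space n → 𝔤) (hχ : IsTestSection χ) (x : Space n) =>
    (hχ.contDiff.differentiable (by simp)) x
  have hparts : ∫ x, inner ℝ (φ x) (fderiv ℝ ψ x v) = -∫ x, inner ℝ (fderiv ℝ φ x v) (ψ x) :=
    integral_bilinear_fderiv_right_eq_neg_left_of_integrable (B := innerSL ℝ)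
      (integrable_inner_of_memLp (hφ.memLp_fderiv v) hψ.memLp)
      (integrable_inner_of_memLp hφ.memLp (hψ.memLp_fderiv v))
      (integrable_inner_of_memLp hφ.memLp hψ.memLp)
      (fun x _ => hd φ hφ x) (fun x _ => hd ψ hψ x)
  have hlie : ∫ x, inner ℝ ⁅A.toFun i x, φ x⁆ (ψ x) = -∫ x, inner ℝ (φ x) ⁅A.toFun i x, ψ x⁆ := by
    rw [← integral_neg]
    exact integral_congr_ae (Eventually.of_forall fun x => inner_lie_comm _ _ _)
  simp only [covDeriv, inner_add_left, inner_add_right]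
  rw [integral_add (integrable_inner_of_memLp (hφ.memLp_fderiv v) hψ.memLp)
      (integrable_inner_of_memLp (hφ.memLp_lie A i) hψ.memLp),
    integral_add (integrable_inner_of_memLp hφ.memLp (hψ.memLp_fderiv v))
      (integrable_inner_of_memLp hφ.memLp (hψ.memLp_lie A i)), hparts, hlie]
  ring

/-- A square-integrable section orthogonal to all test sections vanishes. -/
theorem eq_zero_of_forall_isTestSection (f : L2Section n 𝔤)
    (h : ∀ ψ : Space n → 𝔤, ∀ hψ : IsTestSection ψ, inner ℝ f (hψ.memLp.toLp ψ) = 0) : f = 0 := by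
  have hloc : LocallyIntegrable f volume := (Lp.memLp f).locallyIntegrable (by norm_num)
  rw [Lp.eq_zero_iff_ae_eq_zero]
  refine ae_eq_zero_of_integral_contDiff_smul_eq_zero hloc fun g hg hgs => ?_
  have hint : Integrable (fun x => g x • f x) volume :=
    hloc.integrable_smul_left_of_hasCompactSupport hg.continuous hgs
  refine ext_inner_right ℝ fun e => ?_
  have hψ : IsTestSection fun x => g x • e :=
    ⟨hg.smul contDiff_const, hgs.smul_right⟩
  have h0 := h _ hψ
  rw [L2_inner_eq_integral f _ (EventuallyEq.refl _ _) hψ.memLp.coeFn_toLp] at h0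
  rw [inner_zero_left, real_inner_comm, ← integral_inner hint, ← h0]
  refine integral_congr_ae (Eventually.of_forall fun x => ?_)
  simp only [real_inner_smul_right, real_inner_comm e]

/-- The element of the graph of `∇̂` given by a test section. -/
theorem IsTestSection.mem_covGradGraph {φ : Space n → 𝔤} (hφ : IsTestSection φ) :
    (hφ.memLp.toLp φ, WithLp.toLp 2 fun i => (hφ.memLp_covDeriv A i).toLp _) ∈ covGradGraph A :=
  ⟨φ, hφ, hφ.memLp.coeFn_toLp, fun i => (hφ.memLp_covDeriv A i).coeFn_toLp⟩

theorem dense_covGrad_domain : Dense ((covGrad A).domain : Set (L2Section n 𝔤)) := by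
  rw [Submodule.dense_iff_topologicalClosure_eq_top, Submodule.topologicalClosure_eq_top_iff,
    Submodule.eq_bot_iff]
  refine fun f hf => eq_zero_of_forall_isTestSection f fun ψ hψ => ?_
  have hmem : hψ.memLp.toLp ψ ∈ (covGrad A).domain :=
    Submodule.mem_map.2 ⟨_, hψ.mem_covGradGraph A, rfl⟩
  exact Submodule.inner_left_of_mem_orthogonal hmem hf

/-- For fixed `ψ` both sides are continuous in `p`, so integration by parts survives the closure; at
`p.1 = 0` it gives closability. -/
theorem inner_of_mem_closure {p : L2Section n 𝔤 × L2OneForm n 𝔤}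
    (hp : p ∈ (covGradGraph A).topologicalClosure) {ψ : Space n → 𝔤} (hψ : IsTestSection ψ) :
    inner ℝ (p.2 i) (hψ.memLp.toLp ψ) = -inner ℝ p.1 ((hψ.memLp_covDeriv A i).toLp _) := by
  have hcl : IsClosed {p : L2Section n 𝔤 × L2OneForm n 𝔤 |
      inner ℝ (p.2 i) (hψ.memLp.toLp ψ) = -inner ℝ p.1 ((hψ.memLp_covDeriv A i).toLp _)} :=
    isClosed_eq (by fun_prop) (by fun_prop)
  refine closure_minimal ?_ hcl hp
  rintro q ⟨φ, hφ, h1, h2⟩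
  change inner ℝ (q.2 i) _ = -inner ℝ q.1 _
  rw [L2_inner_eq_integral _ _ (h2 i) hψ.memLp.coeFn_toLp,
    L2_inner_eq_integral _ _ h1 (hψ.memLp_covDeriv A i).coeFn_toLp,
    integral_inner_covDeriv A i hφ hψ]

theorem isClosable_covGrad : (covGrad A).IsClosable := by
  refine ⟨((covGradGraph A).topologicalClosure).toLinearPMap, ?_⟩
  rw [covGrad_graph, Submodule.toLinearPMap_graph_eq]
  intro p hp h0
  ext1 i
  refine eq_zero_of_forall_isTestSection _ fun ψ hψ => ?_
  rw [inner_of_mem_closure A i hp hψ, h0, inner_zero_left, neg_zero]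

theorem neg_covLaplacian :
    -covLaplacian A = pcomp (covGrad A).adjoint (covGrad A).closure := by
  rw [covLaplacian, neg_neg]

end

end GaugeHeat

end

/-- The heat semigroup `e^{tΔ_A} = ∫ e^{-tλ} dE_λ` of the gauge-covariant Laplacian of an
irreducible connection is smoothing on `L²`, with a constant depending on `k` only. -/
theorem mainTheorem6 :
    ∃ C : ℕ → ℝ, ∀ (n : ℕ) (𝔤 : Type*) [GaugeHeat.NormedLieRing 𝔤]
      [GaugeHeat.InvariantLieAlgebra 𝔤] [FiniteDimensional ℝ 𝔤]
      (A : GaugeHeat.Connection n 𝔤), A.Irreducible →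
      (∃ E : GaugeHeat.ResolutionOfIdentity (GaugeHeat.L2Section n 𝔤),
        E.IsSpectralResolution (-GaugeHeat.covLaplacian A)) ∧
      ∀ E : GaugeHeat.ResolutionOfIdentity (GaugeHeat.L2Section n 𝔤),
        E.IsSpectralResolution (-GaugeHeat.covLaplacian A) →
        ∀ t : ℝ, 0 < t →
          ∃ S : GaugeHeat.L2Section n 𝔤 →L[ℝ] GaugeHeat.L2Section n 𝔤,
            (∀ f, E.HasIntegral (fun a => Real.exp (-(t * a))) f (S f)) ∧
            ∀ k : ℕ, 1 ≤ k → ∀ f,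
              GaugeHeat.MemDomPow (-GaugeHeat.covLaplacian A) k (S f) ∧
              GaugeHeat.sobolevNorm (-GaugeHeat.covLaplacian A) k (S f)
                ≤ C k * (1 + (t ^ k)⁻¹) * ‖f‖ := by
  refine ⟨fun k => (2 * k + 1 : ℕ) * k.factorial, fun n 𝔤 _ _ _ A _ => ?_⟩
  have hD := GaugeHeat.dense_covGrad_domain A
  have hc := GaugeHeat.isClosable_covGrad A
  rw [GaugeHeat.neg_covLaplacian]
  refine ⟨GaugeHeat.exists_isSpectralResolution_adjoint_comp_closure hD hc,
    fun E hE t ht => ?_⟩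
  -- The resolution `E` is arbitrary here, so its support in `[0, ∞)` is deduced from `⟪D* D x, x⟫ =
  -- ‖D x‖²`.
  have hE0 := hE.nonneg (GaugeHeat.inner_adjoint_comp_closure_nonneg hD hc)
  exact ⟨E.fc (GaugeHeat.ResolutionOfIdentity.heatFun t 0), hE0.hasIntegral_heat ht,
    fun k _ f => ⟨hE.memDomPow_heat hE0 ht k f, hE.sobolevNorm_heat_le hE0 ht k f⟩⟩
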